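/- In the online bin covering problem the input is a finite sequence $\sigma$ of items with sizes in $(0,1]$. The items arrive one at a time, and each must be placed irrevocably into a bin; a bin is covered if the total size of its items is at least $1$. Let $\mathrm{opt}(\sigma)$ be the maximum number of bins that can be covered by any (offline) packing of $\sigma$. A (deterministic) online algorithm with advice decides where to place the $i$-th item as a function of the sizes of the first $i$ items and of an infinite binary advice tape $\Phi$, and $A(\sigma,\Phi)$ denotes the number of bins that $A$ covers. The algorithm accesses at most $s$ bits of $\Phi$ on $\sigma$ if its decisions on $\sigma$ depend only on the first $s$ bits of $\Phi$. The algorithm $A$ is asymptotically $c$-competitive with advice complexity $s(n)$ if there is a function $b$ with $b(m)=o(m)$ as $m\to\infty$ such that for all $n$ and all inputs $\sigma$ of length at most $n$ there is an advice tape $\Phi$ for which $A$ accesses at most $s(n)$ bits of $\Phi$ on $\sigma$ and $A(\sigma,\Phi)\ge c\cdot\mathrm{opt}(\sigma)-b(\mathrm{opt}(\sigma))$. Its asymptotic competitive ratio is the supremum of all such $c$. **Theorem.** There is an online bin covering algorithm with advice complexity $s(n)=O(\log\log n)$ whose asymptotic competitive ratio is at least $8/15$; in fact, it is asymptotically $\frac{8}{15}$-competitive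 with this advice complexity. -/

import Mathlib

open Filter Asymptotics

noncomputable section

namespace BinCovering

/-- An input: a finite sequence of item sizes, each in the interval `(0, 1]`. -/
def IsInput (σ : List ℝ) : Prop :=
  ∀ x ∈ σ, 0 < x ∧ x ≤ 1

/-- The level of bin `k` in a packing `p` of `σ` (item `i` goes to bin `p i`; the bins are
labelled by natural numbers): the total size of the items in that bin. -/
def level (σ : List ℝ) (p : Fin σ.length → ℕ) (k : ℕ) : ℝ :=
  ∑ i : Fin σ.length, if p i = k then σ.get i else 0

open Classical in
/-- The number of bins covered by a packing `p` of `σ`: the bins that receive an item and whose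
level is at least `1`. -/
def coveredBins (σ : List ℝ) (p : Fin σ.length → ℕ) : ℕ :=
  ((Finset.univ.image p).filter (fun k => 1 ≤ level σ p k)).card

/-- The number of bins covered by an optimal offline algorithm: the maximum over all packings. -/
def opt (σ : List ℝ) : ℕ :=
  sSup (Set.range (coveredBins σ))

theorem coveredBins_le_length (σ : List ℝ) (p : Fin σ.length → ℕ) :
    coveredBins σ p ≤ σ.length := by
  classical
  unfold coveredBins
  refine (Finset.card_filter_le _ _).trans (Finset.card_image_le.trans ?_)
  simp

theorem bddAbove_coveredBins (σ : List ℝ) : BddAbove (Set.range (coveredBins σ)) := by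
  refine ⟨σ.length, ?_⟩
  rintro _ ⟨p, rfl⟩
  exact coveredBins_le_length σ p

/-- No packing covers more bins than the optimum. -/
theorem coveredBins_le_opt (σ : List ℝ) (p : Fin σ.length → ℕ) : coveredBins σ p ≤ opt σ :=
  le_csSup (bddAbove_coveredBins σ) ⟨p, rfl⟩

/-- The optimum is attained by some packing. -/
theorem exists_coveredBins_eq_opt (σ : List ℝ) :
    ∃ p : Fin σ.length → ℕ, coveredBins σ p = opt σ :=
  Nat.sSup_mem (Set.range_nonempty _) (bddAbove_coveredBins σ)

/-- The advice tape: an infinite sequence of bits. -/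
abbrev AdviceTape : Type := ℕ → Bool

/-- A deterministic online bin covering algorithm with advice. Its decision on the `i`-th item is a
function of the content of the advice tape and of the sizes of the first `i` items only:
`place Φ [x₁, …, xᵢ]` is the bin that receives the item `xᵢ`. Decisions are never revised. -/
structure OnlineAlgorithm where
  place : AdviceTape → List ℝ → ℕ

namespace OnlineAlgorithm

/-- The packing of `σ` produced by the algorithm with the advice tape `Φ`. -/
def packing (A : OnlineAlgorithm) (Φ : AdviceTape) (σ : List ℝ) : Fin σ.length → ℕ :=
  fun i => A.place Φ (σ.take ((i : ℕ) + 1))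

/-- While it processes `σ` with the tape `Φ`, the algorithm accesses only the first `s` bits of the
tape: none of its decisions depends on the content of the rest of the tape. (On a tape that is not
a possible advice an algorithm may depend on infinitely many bits.) -/
def AccessesAtMost (A : OnlineAlgorithm) (Φ : AdviceTape) (σ : List ℝ) (s : ℕ) : Prop :=
  ∀ Φ' : AdviceTape, (∀ j < s, Φ' j = Φ j) → A.packing Φ' σ = A.packing Φ σ

/-- `A` is asymptotically `c`-competitive with advice complexity `s(n)`: there is an additive
term `b`, of order `o(opt)`, such that for all `n` and all inputs `σ` of length at most `n` there is
an advice with which `A` covers at least `c * opt σ - b (opt σ)` bins while it accesses at most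
`s n` bits. -/
def IsAsymptoticallyCompetitive (A : OnlineAlgorithm) (s : ℕ → ℕ) (c : ℝ) : Prop :=
  ∃ b : ℕ → ℝ, b =o[atTop] (fun m : ℕ => (m : ℝ)) ∧
    ∀ (n : ℕ) (σ : List ℝ), IsInput σ → σ.length ≤ n →
      ∃ Φ : AdviceTape, A.AccessesAtMost Φ σ (s n) ∧
        c * (opt σ : ℝ) - b (opt σ) ≤ (coveredBins σ (A.packing Φ σ) : ℝ)

/-- The asymptotic competitive ratio of `A` with advice complexity `s(n)`: the supremum, in the
extended reals, of all `c` for which `A` is asymptotically `c`-competitive. -/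
def asymptoticCompetitiveRatio (A : OnlineAlgorithm) (s : ℕ → ℕ) : EReal :=
  sSup {r : EReal | ∃ c : ℝ, A.IsAsymptoticallyCompetitive s c ∧ r = (c : EReal)}

end OnlineAlgorithm

end BinCovering

end

/-!
The algorithm distinguishes large items, of size at least `1/2`, medium items, of size between
`1/10` and `1/2`, and the items of size at most `1/10`. Packing the large items in pairs, and all
others greedily into one bin at a time, covers about `L / 2 + 2 / 3 * S` bins, where `L` is the
number of large items and `S` is the total size of the others. This is close to half of the optimum
only if most optimal bins have exactly one large item and hardly anything else. In this case the
algorithm covers `k` bins with a single large item each, and the advice describes `k` and how to do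
that.

There are `k` waiting bins, which collect small items and then receive a large item, and at most `k`
single large items, which collect small items. A large item is *good* for a threshold `ξ` if its
size is at least `1 - ξ`. When there are too many single items, the smallest one is paired with the
next large item, so that every pair contains a bad item unless the single items are good anyway
(`Balanced`). Thus good items remain if there are enough more good than bad ones. The waiting bins
are filled up to a level `ζ` between `ξ` and `3 / 2 * ξ`. As long as they are not full, all relevant
small items go there or cover a bin at once; as soon as they are full, each good item covers one of
them, so the first single item is good and remains first until small items cover it. Hence no relevant small item is wasted (`Thrifty`), and the target `k` is reached if a little
more than `9 / 2 * k` bins of an optimal packing have small items of total size at least `ξ`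
(`gain_run_eq`). With the threshold `ξ` for which about `(L + k) / 2` large items are good, this
holds for a target `k` that is large enough for the ratio `8/15` (`exists_params`).

The level `ζ` may be arbitrarily small, so that it cannot be described with few bits. The sizes are
therefore divided into scales that differ by a factor of more than the number of items. An item
fills the waiting bins up to the level that belongs to its own scale. Items of smaller scales than
that of `ζ` are negligible, and the few bits of the advice describe only the position of `ζ` within
its scale (`Params.ofScale`, `exists_fits`). The advice then consists of numbers of order `log n`,
and `k` is given up to a factor of `21/20`, as a power of `21/20`.
-/

noncomputable section

namespace BinCovering

/-! ### The algorithm for fixed parameters -/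

/-- An open bin. `big` is the size of its item of size at least `1/2`, or `0` if there is none;
`fill` is the total size of its items smaller than `1/2`. -/
structure Bin where
  /-- The label of the bin in the packing. -/
  label : ℕ
  /-- The size of the large item in the bin, or `0`. -/
  big : ℝ
  /-- The total size of the small items in the bin. -/
  fill : ℝ

/-- The total size of the items in an open bin. -/
def Bin.level (b : Bin) : ℝ := b.big + b.fill

/-- What the advice tells the algorithm. -/
structure Params where
  /-- The number of bins that should be covered with a single large item. -/
  target : ℕ
  /-- A bound for the total size of the small items that are spent on bins with a large item. -/
  budget : ℝ
  /-- Whether a small item of size `y` may be added to a waiting bin with level `ℓ`. -/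
  wants : ℝ → ℝ → Prop

/-- The state of the algorithm. -/
structure State where
  /-- Bins with small items only that wait for a large item, with increasing fill. -/
  waiting : List Bin
  /-- Bins with one large item that wait for small items, with decreasing large item. -/
  singles : List Bin
  /-- At most one bin with a large item that will receive the next large item. -/
  spare : List Bin
  /-- The bin into which the remaining small items are packed. -/
  current : Bin
  /-- The number of bins covered so far with a single large item. -/
  gain : ℕ
  /-- The total size of the small items that were put into bins of `singles`. -/
  used : ℝ
  /-- A bound for the labels in use. -/
  fresh : ℕ
  /-- The number of covered bins. -/
  covered : ℕ
  /-- The label of the bin that received the last item. -/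
  last : ℕ

open Classical in
/-- Insertion into a list of bins that is sorted by increasing `key`. -/
def insertBy (key : Bin → ℝ) (b : Bin) (l : List Bin) : List Bin :=
  l.orderedInsert (fun a c => key a ≤ key c) b

theorem insertBy_perm (key : Bin → ℝ) (b : Bin) (l : List Bin) :
    (insertBy key b l).Perm (b :: l) :=
  List.perm_orderedInsert _ _ _

theorem pairwise_insertBy (key : Bin → ℝ) (b : Bin) {l : List Bin}
    (h : l.Pairwise fun a c => key a ≤ key c) :
    (insertBy key b l).Pairwise fun a c => key a ≤ key c := by
  classical
  have : Std.Total (fun a c : Bin => key a ≤ key c) := ⟨fun a c => le_total _ _⟩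
  have : IsTrans Bin (fun a c : Bin => key a ≤ key c) := ⟨fun _ _ _ => le_trans⟩
  exact List.Pairwise.orderedInsert _ _ h

theorem insertBy_cons_of_lt (key : Bin → ℝ) {b c : Bin} (l : List Bin) (h : key c < key b) :
    insertBy key b (c :: l) = c :: insertBy key b l := by
  classical
  exact List.orderedInsert_of_not_le _ _ (not_le.2 h)

/-- The order of `State.singles`: by decreasing large item. -/
def Bin.rank (b : Bin) : ℝ := -b.big

namespace State

/-- The initial state: there are `k` empty waiting bins. -/
def init (k : ℕ) : State where
  waiting := (List.range k).map fun i => ⟨i, 0, 0⟩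
  singles := []
  spare := []
  current := ⟨k, 0, 0⟩
  gain := 0
  used := 0
  fresh := k + 1
  covered := 0
  last := 0

/-- The large item `x` opens a bin. The bin joins `singles`; if there are more than `c` of these
then, the one with the smallest large item becomes the spare bin. -/
def openSingle (s : State) (c : ℕ) (x : ℝ) : State :=
  { s with
    singles := (insertBy Bin.rank ⟨s.fresh, x, 0⟩ s.singles).take c
    spare := (insertBy Bin.rank ⟨s.fresh, x, 0⟩ s.singles).drop c
    fresh := s.fresh + 1
    last := s.fresh }

/-- The large item `x` covers the waiting bin `p`. -/
def coverWaiting (s : State) (c : ℕ) (p : Bin) (ps : List Bin) : State :=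
  { s with
    waiting := ps
    singles := s.singles.take c
    spare := s.singles.drop c
    gain := s.gain + 1
    covered := s.covered + 1
    last := p.label }

/-- A large item is paired with the one in the spare bin `w`. -/
def coverSpare (s : State) (w : Bin) (ws : List Bin) : State :=
  { s with spare := ws, covered := s.covered + 1, last := w.label }

/-- The small item `x` covers the bin `u`, which has a large item. -/
def coverSingle (s : State) (x : ℝ) (u : Bin) (us : List Bin) : State :=
  { s with
    singles := us
    gain := s.gain + 1
    used := s.used + x
    covered := s.covered + 1
    last := u.label }

/-- The small item `x` is added to the waiting bin `p`. -/
def fillWaiting (s : State) (x : ℝ) (p : Bin) (ps : List Bin) : State :=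
  { s with
    waiting := insertBy Bin.fill ⟨p.label, p.big, p.fill + x⟩ ps
    last := p.label }

/-- The small item `x` is added to the bin `u`, which has a large item. -/
def fillSingle (s : State) (x : ℝ) (u : Bin) (us : List Bin) : State :=
  { s with
    singles := ⟨u.label, u.big, u.fill + x⟩ :: us
    used := s.used + x
    last := u.label }

/-- The small item `x` is added to the current bin. -/
def fillCurrent (s : State) (x : ℝ) : State :=
  { s with
    current := ⟨s.current.label, s.current.big, s.current.fill + x⟩
    last := s.current.label }

/-- The small item `x` covers the current bin, and a new one is opened. -/
def coverCurrent (s : State) : State :=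
  { s with
    current := ⟨s.fresh, 0, 0⟩
    fresh := s.fresh + 1
    covered := s.covered + 1
    last := s.current.label }

open Classical in
/-- The placement of a large item. -/
def stepLarge (π : Params) (s : State) (x : ℝ) : State :=
  match s.spare, s.waiting with
  | w :: ws, _ => s.coverSpare w ws
  | [], [] => s.openSingle (π.target - s.gain) x
  | [], p :: ps =>
    if s.gain < π.target ∧ 1 ≤ p.fill + x then s.coverWaiting (π.target - (s.gain + 1)) p ps
    else s.openSingle (π.target - s.gain) x

open Classical in
/-- The placement of a small item in the current bin. -/
def stepCurrent (s : State) (x : ℝ) : State :=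
  if 1 ≤ s.current.level + x then s.coverCurrent else s.fillCurrent x

open Classical in
/-- The placement of a small item in the first bin of `singles`. -/
def stepSingle (π : Params) (s : State) (x : ℝ) : State :=
  match s.singles with
  | [] => s.stepCurrent x
  | u :: us => if s.used ≤ π.budget then s.fillSingle x u us else s.stepCurrent x

open Classical in
/-- The placement of a small item in the first waiting bin, if this is allowed. -/
def stepWaiting (π : Params) (s : State) (x : ℝ) : State :=
  match s.waiting with
  | [] => s.stepSingle π x
  | p :: ps => if π.wants x p.fill then s.fillWaiting x p ps else s.stepSingle π x

open Classical in
/-- The placement of a small item of size at most `1/10`. -/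
def stepSmall (π : Params) (s : State) (x : ℝ) : State :=
  match s.singles with
  | [] => s.stepWaiting π x
  | u :: us =>
    if s.used ≤ π.budget ∧ 1 ≤ u.level + x then s.coverSingle x u us else s.stepWaiting π x

open Classical in
/-- The state after the next item, of size `x`. -/
def step (π : Params) (s : State) (x : ℝ) : State :=
  if 1 / 2 ≤ x then s.stepLarge π x
  else if x ≤ 1 / 10 then s.stepSmall π x
  else s.stepCurrent x

/-- The state of the algorithm after the input `σ`. -/
def run (π : Params) (σ : List ℝ) : State :=
  σ.foldl (step π) (init π.target)

theorem run_append_singleton (π : Params) (σ : List ℝ) (x : ℝ) :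
    run π (σ ++ [x]) = (run π σ).step π x := by
  simp [run]

end State

open State

/-- The transitions of the algorithm: `Move π s x t` if the item `x` takes it from the state `s` to
the state `t`. -/
inductive Move (π : Params) (s : State) (x : ℝ) : State → Prop
  | coverSpare (w : Bin) (ws : List Bin) (hx : 1 / 2 ≤ x) (hw : s.spare = w :: ws) :
      Move π s x (s.coverSpare w ws)
  | coverWaiting (p : Bin) (ps : List Bin) (hx : 1 / 2 ≤ x) (hw : s.spare = [])
      (hp : s.waiting = p :: ps) (hg : s.gain < π.target) (hc : 1 ≤ p.fill + x) :
      Move π s x (s.coverWaiting (π.target - (s.gain + 1)) p ps)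
  | openSingle (hx : 1 / 2 ≤ x) (hw : s.spare = [])
      (hc : s.gain < π.target → ∀ p ps, s.waiting = p :: ps → p.fill + x < 1) :
      Move π s x (s.openSingle (π.target - s.gain) x)
  | coverSingle (u : Bin) (us : List Bin) (hx : x ≤ 1 / 10) (hu : s.singles = u :: us)
      (hb : s.used ≤ π.budget) (hc : 1 ≤ u.level + x) :
      Move π s x (s.coverSingle x u us)
  | fillWaiting (p : Bin) (ps : List Bin) (hx : x ≤ 1 / 10) (hp : s.waiting = p :: ps)
      (hw : π.wants x p.fill)
      (hc : ∀ u us, s.singles = u :: us → s.used ≤ π.budget → u.level + x < 1) :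
      Move π s x (s.fillWaiting x p ps)
  | fillSingle (u : Bin) (us : List Bin) (hx : x ≤ 1 / 10) (hu : s.singles = u :: us)
      (hb : s.used ≤ π.budget) (hc : u.level + x < 1)
      (hw : ∀ p ps, s.waiting = p :: ps → ¬ π.wants x p.fill) :
      Move π s x (s.fillSingle x u us)
  | fillCurrent (hx : x < 1 / 2)
      (hw : x ≤ 1 / 10 → (∀ p ps, s.waiting = p :: ps → ¬ π.wants x p.fill) ∧
        (∀ u us, s.singles = u :: us → π.budget < s.used))
      (hc : s.current.level + x < 1) :
      Move π s x (s.fillCurrent x)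
  | coverCurrent (hx : x < 1 / 2)
      (hw : x ≤ 1 / 10 → (∀ p ps, s.waiting = p :: ps → ¬ π.wants x p.fill) ∧
        (∀ u us, s.singles = u :: us → π.budget < s.used))
      (hc : 1 ≤ s.current.level + x) :
      Move π s x s.coverCurrent

theorem move_stepCurrent {π : Params} {s : State} {x : ℝ} (hx : x < 1 / 2)
    (hw : x ≤ 1 / 10 → (∀ p ps, s.waiting = p :: ps → ¬ π.wants x p.fill) ∧
      (∀ u us, s.singles = u :: us → π.budget < s.used)) :
    Move π s x (s.stepCurrent x) := by
  unfold stepCurrent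
  split_ifs with h
  · exact .coverCurrent hx hw h
  · exact .fillCurrent hx hw (not_le.1 h)

theorem move_stepSingle {π : Params} {s : State} {x : ℝ} (hx : x ≤ 1 / 10)
    (hc : ∀ u us, s.singles = u :: us → s.used ≤ π.budget → u.level + x < 1)
    (hw : ∀ p ps, s.waiting = p :: ps → ¬ π.wants x p.fill) :
    Move π s x (s.stepSingle π x) := by
  unfold stepSingle
  split
  · rename_i h
    exact move_stepCurrent (by linarith) fun _ => ⟨hw, by simp [h]⟩
  · rename_i u us h
    split_ifs with hb
    · exact .fillSingle u us hx h hb (hc u us h hb) hw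
    · exact move_stepCurrent (by linarith) fun _ => ⟨hw, fun _ _ _ => not_le.1 hb⟩

theorem move_stepWaiting {π : Params} {s : State} {x : ℝ} (hx : x ≤ 1 / 10)
    (hc : ∀ u us, s.singles = u :: us → s.used ≤ π.budget → u.level + x < 1) :
    Move π s x (s.stepWaiting π x) := by
  unfold stepWaiting
  split
  · rename_i h
    exact move_stepSingle hx hc (by simp [h])
  · rename_i p ps h
    split_ifs with hw
    · exact .fillWaiting p ps hx h hw hc
    · refine move_stepSingle hx hc fun p' ps' h' => ?_
      rw [h] at h'
      cases h'
      exact hw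

theorem move_step (π : Params) (s : State) (x : ℝ) : Move π s x (s.step π x) := by
  unfold step
  split_ifs with hx hx'
  · unfold stepLarge
    split
    · rename_i w ws h
      exact .coverSpare w ws hx h
    · rename_i h h'
      exact .openSingle hx h (by simp [h'])
    · rename_i p ps h h'
      split_ifs with hc
      · exact .coverWaiting p ps hx h h' hc.1 hc.2
      · refine .openSingle hx h fun hg p' ps' hp => ?_
        rw [h'] at hp
        cases hp
        exact not_le.1 fun hle => hc ⟨hg, hle⟩
  · unfold stepSmall
    split
    · rename_i h
      exact move_stepWaiting hx' (by simp [h])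
    · rename_i u us h
      split_ifs with hc
      · exact .coverSingle u us hx' h hc.1 hc.2
      · refine move_stepWaiting hx' fun u' us' hu hb => ?_
        rw [h] at hu
        cases hu
        exact not_le.1 fun hle => hc ⟨hb, hle⟩
  · exact move_stepCurrent (not_le.1 hx) fun h => absurd h hx'

/-! ### The packing that the algorithm produces -/

/-- The levels `lev` of all bins agree with the list `m` of open bins and the set `C` of labels of
covered bins; the labels from `n` on are not in use. -/
structure Tracks (lev : ℕ → ℝ) (C : Finset ℕ) (m : Multiset Bin) (n : ℕ) : Prop where
  nodup : (m.map Bin.label).Nodup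
  lt : ∀ b ∈ m, b.label < n
  level : ∀ b ∈ m, lev b.label = b.level
  notMem : ∀ b ∈ m, b.label ∉ C
  covered : ∀ i ∈ C, i < n ∧ 1 ≤ lev i
  zero : ∀ i, n ≤ i → lev i = 0

/-- The levels after an item `x` was put into the bin `i`. -/
def bump (lev : ℕ → ℝ) (i : ℕ) (x : ℝ) : ℕ → ℝ := fun j => lev j + if i = j then x else 0

theorem Tracks.add {lev : ℕ → ℝ} {C : Finset ℕ} {m : Multiset Bin} {n : ℕ} {b b' : Bin} {x : ℝ}
    (h : Tracks lev C (b ::ₘ m) n) (hl : b'.label = b.label) (hb : b'.level = b.level + x) :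
    Tracks (bump lev b.label x) C (b' ::ₘ m) n := by
  have hne : ∀ c ∈ m, b.label ≠ c.label := by
    intro c hc heq
    have := h.nodup
    rw [Multiset.map_cons, Multiset.nodup_cons] at this
    exact this.1 (heq ▸ Multiset.mem_map_of_mem _ hc)
  refine ⟨?_, ?_, ?_, ?_, ?_, ?_⟩
  · simpa [hl] using h.nodup
  · intro c hc
    rcases Multiset.mem_cons.1 hc with rfl | hc
    · rw [hl]; exact h.lt b (Multiset.mem_cons_self _ _)
    · exact h.lt c (Multiset.mem_cons_of_mem hc)
  · intro c hc
    rcases Multiset.mem_cons.1 hc with rfl | hc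
    · simp [bump, hl, hb, h.level b (Multiset.mem_cons_self _ _)]
    · simp [bump, hne c hc, h.level c (Multiset.mem_cons_of_mem hc)]
  · intro c hc
    rcases Multiset.mem_cons.1 hc with rfl | hc
    · rw [hl]; exact h.notMem b (Multiset.mem_cons_self _ _)
    · exact h.notMem c (Multiset.mem_cons_of_mem hc)
  · intro i hi
    have : b.label ≠ i := fun heq => h.notMem b (Multiset.mem_cons_self _ _) (heq ▸ hi)
    simpa [bump, this] using h.covered i hi
  · intro i hi
    have := h.lt b (Multiset.mem_cons_self _ _)
    have hne' : b.label ≠ i := by omega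
    simp [bump, hne', h.zero i hi]

theorem Tracks.close {lev : ℕ → ℝ} {C : Finset ℕ} {m : Multiset Bin} {n : ℕ} {b : Bin} {x : ℝ}
    (h : Tracks lev C (b ::ₘ m) n) (hb : 1 ≤ b.level + x) :
    Tracks (bump lev b.label x) (insert b.label C) m n := by
  have h' := h.add (b' := ⟨b.label, b.big, b.fill + x⟩) (x := x) rfl
    (by simp only [Bin.level]; ring)
  have hn := h'.nodup
  rw [Multiset.map_cons, Multiset.nodup_cons] at hn
  refine ⟨hn.2, fun c hc => h'.lt c (Multiset.mem_cons_of_mem hc),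
    fun c hc => h'.level c (Multiset.mem_cons_of_mem hc), ?_, ?_, h'.zero⟩
  · intro c hc
    rw [Finset.mem_insert, not_or]
    exact ⟨fun heq => hn.1 (by rw [← heq]; exact Multiset.mem_map_of_mem _ hc),
      h'.notMem c (Multiset.mem_cons_of_mem hc)⟩
  · intro i hi
    rcases Finset.mem_insert.1 hi with rfl | hi
    · refine ⟨h.lt b (Multiset.mem_cons_self _ _), ?_⟩
      simpa [bump, h.level b (Multiset.mem_cons_self _ _)] using hb
    · exact h'.covered i hi

theorem Tracks.new {lev : ℕ → ℝ} {C : Finset ℕ} {m : Multiset Bin} {n : ℕ}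
    (h : Tracks lev C m n) : Tracks lev C (⟨n, 0, 0⟩ ::ₘ m) (n + 1) := by
  refine ⟨?_, ?_, ?_, ?_, ?_, ?_⟩
  · rw [Multiset.map_cons, Multiset.nodup_cons]
    refine ⟨fun hm => ?_, h.nodup⟩
    obtain ⟨c, hc, hcn⟩ := Multiset.mem_map.1 hm
    have := h.lt c hc
    simp only at hcn
    omega
  · intro c hc
    rcases Multiset.mem_cons.1 hc with rfl | hc
    · simp
    · exact (h.lt c hc).trans (Nat.lt_succ_self n)
  · intro c hc
    rcases Multiset.mem_cons.1 hc with rfl | hc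
    · simp [Bin.level, h.zero n le_rfl]
    · exact h.level c hc
  · intro c hc
    rcases Multiset.mem_cons.1 hc with rfl | hc
    · exact fun hi => absurd (h.covered n hi).1 (lt_irrefl _)
    · exact h.notMem c hc
  · exact fun i hi => ⟨(h.covered i hi).1.trans (Nat.lt_succ_self n), (h.covered i hi).2⟩
  · exact fun i hi => h.zero i ((Nat.le_succ n).trans hi)

namespace State

/-- The open bins. -/
def bins (s : State) : Multiset Bin :=
  (s.waiting : Multiset Bin) + s.singles + s.spare + {s.current}

end State

theorem coe_take_add_drop (l : List Bin) (c : ℕ) :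
    ((l.take c : List Bin) : Multiset Bin) + (l.drop c : List Bin) = l := by
  rw [Multiset.coe_add, List.take_append_drop]

theorem coe_insertBy (key : Bin → ℝ) (b : Bin) (l : List Bin) :
    ((insertBy key b l : List Bin) : Multiset Bin) = b ::ₘ (l : Multiset Bin) :=
  Multiset.coe_eq_coe.2 (insertBy_perm key b l)

/-- A move updates the levels of the bins as the packing does. -/
theorem Move.tracks {π : Params} {s t : State} {x : ℝ} (hm : Move π s x t) {lev : ℕ → ℝ}
    {C : Finset ℕ} (hP : ∀ p ∈ s.waiting, p.big = 0) (hW : ∀ w ∈ s.spare, 1 / 2 ≤ w.level)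
    (hC : C.card = s.covered) (h : Tracks lev C s.bins s.fresh) :
    ∃ C' : Finset ℕ, C'.card = t.covered ∧ Tracks (bump lev t.last x) C' t.bins t.fresh := by
  have key : ∀ (b : Bin) (m : Multiset Bin), s.bins = b ::ₘ m → 1 ≤ b.level + x →
      ∃ C' : Finset ℕ, C'.card = s.covered + 1 ∧ Tracks (bump lev b.label x) C' m s.fresh := by
    intro b m hb hx
    rw [hb] at h
    exact ⟨insert b.label C, by
      rw [Finset.card_insert_of_notMem (h.notMem b (Multiset.mem_cons_self _ _)), hC],
      h.close hx⟩
  cases hm with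
  | coverSpare w ws hx hw =>
    have := hW w (by simp [hw])
    refine key w _ ?_ (by linarith)
    simp only [State.bins, hw, State.coverSpare, ← Multiset.cons_coe, ← Multiset.singleton_add]
    abel
  | coverWaiting p ps hx hw hp hg hc =>
    have := hP p (by simp [hp])
    refine key p _ ?_ (by unfold Bin.level; linarith)
    simp only [State.bins, State.coverWaiting]
    rw [add_assoc (ps : Multiset Bin), coe_take_add_drop, hp, hw]
    simp only [← Multiset.cons_coe, ← Multiset.singleton_add, Multiset.coe_nil]
    abel
  | openSingle hx hw hc =>
    refine ⟨C, hC, ?_⟩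
    have := h.new.add (b' := ⟨s.fresh, x, 0⟩) (x := x) rfl (by simp [Bin.level])
    have e : (s.openSingle (π.target - s.gain) x).bins = ⟨s.fresh, x, 0⟩ ::ₘ s.bins := by
      simp only [State.bins, State.openSingle]
      rw [add_assoc (s.waiting : Multiset Bin), coe_take_add_drop, coe_insertBy, hw]
      simp only [← Multiset.singleton_add, Multiset.coe_nil]
      abel
    rw [e]
    exact this
  | coverSingle u us hx hu hb hc =>
    refine key u _ ?_ hc
    simp only [State.bins, hu, State.coverSingle, ← Multiset.cons_coe, ← Multiset.singleton_add]
    abel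
  | fillWaiting p ps hx hp hw hc =>
    refine ⟨C, hC, ?_⟩
    have e : s.bins = p ::ₘ ((ps : Multiset Bin) + s.singles + s.spare + {s.current}) := by
      simp only [State.bins, hp, ← Multiset.cons_coe, ← Multiset.singleton_add]
      abel
    rw [e] at h
    have := h.add (b' := ⟨p.label, p.big, p.fill + x⟩) (x := x) rfl
      (by simp only [Bin.level]; ring)
    have e' : (s.fillWaiting x p ps).bins = (⟨p.label, p.big, p.fill + x⟩ : Bin) ::ₘ
        ((ps : Multiset Bin) + s.singles + s.spare + {s.current}) := by
      simp only [State.bins, State.fillWaiting, coe_insertBy, ← Multiset.singleton_add]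
      abel
    rw [e']
    exact this
  | fillSingle u us hx hu hb hc hw =>
    refine ⟨C, hC, ?_⟩
    have e : s.bins = u ::ₘ ((s.waiting : Multiset Bin) + us + s.spare + {s.current}) := by
      simp only [State.bins, hu, ← Multiset.cons_coe, ← Multiset.singleton_add]
      abel
    rw [e] at h
    have := h.add (b' := ⟨u.label, u.big, u.fill + x⟩) (x := x) rfl
      (by simp only [Bin.level]; ring)
    have e' : (s.fillSingle x u us).bins = (⟨u.label, u.big, u.fill + x⟩ : Bin) ::ₘ
        ((s.waiting : Multiset Bin) + us + s.spare + {s.current}) := by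
      simp only [State.bins, State.fillSingle, ← Multiset.cons_coe, ← Multiset.singleton_add]
      abel
    rw [e']
    exact this
  | fillCurrent hx hw hc =>
    refine ⟨C, hC, ?_⟩
    have e : s.bins = s.current ::ₘ ((s.waiting : Multiset Bin) + s.singles + s.spare) := by
      simp only [State.bins, ← Multiset.singleton_add]
      abel
    rw [e] at h
    have := h.add (b' := ⟨s.current.label, s.current.big, s.current.fill + x⟩) (x := x) rfl
      (by simp only [Bin.level]; ring)
    have e' : (s.fillCurrent x).bins =
        (⟨s.current.label, s.current.big, s.current.fill + x⟩ : Bin) ::ₘ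
        ((s.waiting : Multiset Bin) + s.singles + s.spare) := by
      simp only [State.bins, State.fillCurrent, ← Multiset.singleton_add]
      abel
    rw [e']
    exact this
  | coverCurrent hx hw hc =>
    obtain ⟨C', h1, h2⟩ := key s.current ((s.waiting : Multiset Bin) + s.singles + s.spare)
      (by simp only [State.bins, ← Multiset.singleton_add]; abel) hc
    refine ⟨C', h1, ?_⟩
    have e' : s.coverCurrent.bins = (⟨s.fresh, 0, 0⟩ : Bin) ::ₘ
        ((s.waiting : Multiset Bin) + s.singles + s.spare) := by
      simp only [State.bins, State.coverCurrent, ← Multiset.singleton_add]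
      abel
    rw [e']
    exact h2.new

/-- The initial state has all levels equal to `0`. -/
theorem tracks_init (k : ℕ) : Tracks (fun _ => 0) ∅ (State.init k).bins (State.init k).fresh := by
  have e : (State.init k).bins = ((List.range (k + 1)).map fun i => (⟨i, 0, 0⟩ : Bin)) := by
    simp [State.bins, State.init, List.range_succ, ← Multiset.coe_add]
  have hb : ∀ b ∈ (State.init k).bins, b.label < k + 1 ∧ b.level = 0 := by
    intro b hb
    rw [e, Multiset.mem_coe, List.mem_map] at hb
    obtain ⟨i, hi, rfl⟩ := hb
    exact ⟨List.mem_range.1 hi, by simp [Bin.level]⟩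
  refine ⟨?_, fun b h => (hb b h).1, fun b h => (hb b h).2.symm, by simp, by simp, by simp⟩
  rw [e, Multiset.map_coe, Multiset.coe_nodup, List.map_map]
  exact (List.map_id (List.range (k + 1))).symm ▸ List.nodup_range

/-- The sum of `f` over the items of `σ`. -/
def total {M : Type*} [AddCommMonoid M] (f : ℝ → M) (σ : List ℝ) : M := (σ.map f).sum

theorem total_append_singleton {M : Type*} [AddCommMonoid M] (f : ℝ → M) (σ : List ℝ) (x : ℝ) :
    total f (σ ++ [x]) = total f σ + f x := by
  simp [total]

theorem level_append_singleton (f : List ℝ → ℕ) (σ : List ℝ) (x : ℝ) :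
    (level (σ ++ [x]) fun i => f ((σ ++ [x]).take ((i : ℕ) + 1))) =
      bump (level σ fun i => f (σ.take ((i : ℕ) + 1))) (f (σ ++ [x])) x := by
  have key : ∀ (τ : List ℝ) (j : ℕ), level τ (fun i => f (τ.take ((i : ℕ) + 1))) j =
      ∑ i ∈ Finset.range τ.length, if f (τ.take (i + 1)) = j then τ.getD i 0 else 0 := by
    intro τ j
    rw [Finset.sum_range]
    simp [level]
  funext j
  unfold bump
  rw [key, key, List.length_append, List.length_singleton, Finset.sum_range_succ]
  congr 1
  · refine Finset.sum_congr rfl fun i hi => ?_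
    have hi' := Finset.mem_range.1 hi
    rw [List.take_append_of_le_length (by omega), List.getD_append _ _ _ _ hi']
  · rw [List.take_of_length_le (by simp), List.getD_append_right _ _ _ _ le_rfl]
    simp

theorem card_le_coveredBins {σ : List ℝ} {p : Fin σ.length → ℕ} {C : Finset ℕ}
    (h : ∀ i ∈ C, 1 ≤ level σ p i) : C.card ≤ coveredBins σ p := by
  classical
  unfold coveredBins
  refine Finset.card_le_card fun i hi => Finset.mem_filter.2 ⟨?_, h i hi⟩
  by_contra hn
  have h0 : level σ p i = 0 := by
    unfold level
    refine Finset.sum_eq_zero fun j _ => if_neg fun hj => hn ?_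
    exact Finset.mem_image.2 ⟨j, Finset.mem_univ _, hj⟩
  have := h i hi
  linarith

/-! ### Accounting -/

/-- The accounting of the algorithm in the state `s`, after `L` large items and small items of
total size `S`. Covered bins with one large item are counted by `s.gain`, those with two large items
by `q`, and those with none by `d`. Every bin that was ever waiting holds small items of total size
at most `T + 1 / 10`. -/
structure Ledger (π : Params) (T : ℝ) (s : State) (L : ℕ) (S : ℝ) : Prop where
  waiting_le : s.waiting.length ≤ π.target
  le_waiting : π.target ≤ s.waiting.length + s.gain
  singles_le : s.singles.length + s.gain ≤ π.target
  spare_le : s.spare.length ≤ 1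
  waiting_sorted : s.waiting.Pairwise fun a c => a.fill ≤ c.fill
  singles_sorted : s.singles.Pairwise fun a c => a.rank ≤ c.rank
  mem_waiting : ∀ p ∈ s.waiting, p.big = 0 ∧ 0 ≤ p.fill ∧ p.fill ≤ T + 1 / 10
  mem_singles : ∀ u ∈ s.singles, 1 / 2 ≤ u.big ∧ 0 ≤ u.fill ∧ u.level < 1
  mem_spare : ∀ w ∈ s.spare, 1 / 2 ≤ w.big ∧ 0 ≤ w.fill
  current_big : s.current.big = 0
  current_nonneg : 0 ≤ s.current.fill
  current_lt : s.current.fill < 1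
  used_le : s.used ≤ π.budget + 1 / 10
  count : ∃ q d : ℕ, s.covered = s.gain + q + d ∧
    L = s.gain + 2 * q + s.singles.length + s.spare.length ∧
    S ≤ (π.target - s.waiting.length) * (T + 1 / 10) + (s.waiting.map Bin.fill).sum + s.used +
      3 / 2 * d + s.current.fill

theorem ledger_init {π : Params} {T : ℝ} (hT : 0 ≤ T) (hb : 0 ≤ π.budget) :
    Ledger π T (State.init π.target) 0 0 := by
  have hmem : ∀ p ∈ (State.init π.target).waiting, p.big = 0 ∧ p.fill = 0 := by
    intro p hp
    obtain ⟨i, _, rfl⟩ := List.mem_map.1 hp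
    exact ⟨rfl, rfl⟩
  have hlen : (State.init π.target).waiting.length = π.target := by simp [State.init]
  have hsum : ((State.init π.target).waiting.map Bin.fill).sum = 0 := by
    simp [State.init, Function.comp_def]
  refine ⟨hlen.le, by rw [hlen]; simp, by simp [State.init], by simp [State.init], ?_,
    by simp [State.init], fun p hp => ⟨(hmem p hp).1, (hmem p hp).2.ge, ?_⟩, by simp [State.init],
    by simp [State.init], rfl, le_rfl, zero_lt_one, ?_, 0, 0, rfl, rfl, ?_⟩
  · rw [List.pairwise_iff_forall_sublist]
    intro a b hab
    rw [(hmem a (hab.subset (by simp))).2, (hmem b (hab.subset (by simp))).2]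
  · rw [(hmem p hp).2]; linarith
  · simp only [State.init]; linarith
  · rw [hlen, hsum]; simp [State.init]

theorem mem_insertBy {key : Bin → ℝ} {b c : Bin} {l : List Bin} :
    c ∈ insertBy key b l ↔ c = b ∨ c ∈ l := by
  rw [(insertBy_perm key b l).mem_iff, List.mem_cons]

theorem length_insertBy (key : Bin → ℝ) (b : Bin) (l : List Bin) :
    (insertBy key b l).length = l.length + 1 := by
  rw [(insertBy_perm key b l).length_eq, List.length_cons]

theorem sum_map_insertBy (key f : Bin → ℝ) (b : Bin) (l : List Bin) :
    ((insertBy key b l).map f).sum = f b + (l.map f).sum := by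
  rw [((insertBy_perm key b l).map f).sum_eq, List.map_cons, List.sum_cons]

/-- The indicator of the sizes of large items. -/
def isLarge (x : ℝ) : ℕ := open Classical in if 1 / 2 ≤ x then 1 else 0

/-- The size of a small item, and `0` for a large item. -/
def smallSize (x : ℝ) : ℝ := open Classical in if 1 / 2 ≤ x then 0 else x

theorem Ledger.move {π : Params} {T : ℝ} {s t : State} {L : ℕ} {S x : ℝ}
    (hT : ∀ y l, π.wants y l → l < T) (hx0 : 0 < x) (h : Ledger π T s L S)
    (hm : Move π s x t) : Ledger π T t (L + isLarge x) (S + smallSize x) := by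
  obtain ⟨q, d, hc, hL, hS⟩ := h.count
  cases hm with
  | coverSpare w ws hx hw =>
    have hsp := h.spare_le
    have hms := h.mem_spare
    rw [hw] at hsp hms hL
    refine { h with
      spare_le := by simp only [State.coverSpare, List.length_cons] at hsp ⊢; omega
      mem_spare := fun w' hw' => hms w' (List.mem_cons_of_mem _ hw')
      count := ⟨q + 1, d, ?_, ?_, ?_⟩ }
    · simp only [State.coverSpare]; omega
    · simp only [State.coverSpare, isLarge, if_pos hx, List.length_cons] at hL ⊢; omega
    · simpa only [State.coverSpare, smallSize, if_pos hx, add_zero] using hS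
  | coverWaiting p ps hx hw hp hg hc' =>
    have h1 := h.waiting_le
    have h2 := h.le_waiting
    have h3 := h.singles_le
    have h4 := h.waiting_sorted
    have h5 := h.mem_waiting
    rw [hp] at h1 h2 h4 h5 hS
    rw [hw] at hL
    simp only [List.length_cons] at h1 h2
    have hpf := (h5 p (by simp)).2.2
    refine { h with
      waiting_le := by simp only [State.coverWaiting]; omega
      le_waiting := by simp only [State.coverWaiting]; omega
      singles_le := by simp only [State.coverWaiting, List.length_take]; omega
      spare_le := by simp only [State.coverWaiting, List.length_drop]; omega
      waiting_sorted := h4.of_cons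
      singles_sorted := h.singles_sorted.sublist (List.take_sublist _ _)
      mem_waiting := fun p' hp' => h5 p' (List.mem_cons_of_mem _ hp')
      mem_singles := fun u hu => h.mem_singles u (List.mem_of_mem_take hu)
      mem_spare := fun w hw => ⟨(h.mem_singles w (List.mem_of_mem_drop hw)).1,
        (h.mem_singles w (List.mem_of_mem_drop hw)).2.1⟩
      count := ⟨q, d, ?_, ?_, ?_⟩ }
    · simp only [State.coverWaiting]; omega
    · simp only [State.coverWaiting, isLarge, if_pos hx, List.length_take, List.length_drop,
        List.length_nil] at hL ⊢
      omega
    · simp only [State.coverWaiting, smallSize, if_pos hx, List.map_cons, List.sum_cons,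
        List.length_cons, Nat.cast_add, Nat.cast_one] at hS ⊢
      linarith
  | openSingle hx hw hc' =>
    have h3 := h.singles_le
    have hlev : s.gain < π.target → x < 1 := by
      intro hg
      have h2 := h.le_waiting
      cases hp : s.waiting with
      | nil => rw [hp] at h2; simp at h2; omega
      | cons p ps =>
        have := hc' hg p ps hp
        have := (h.mem_waiting p (by simp [hp])).2.1
        linarith
    rw [hw] at hL
    refine { h with
      singles_le := ?_
      spare_le := ?_
      singles_sorted := (pairwise_insertBy _ _ h.singles_sorted).sublist (List.take_sublist _ _)
      mem_singles := fun u hu => ?_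
      mem_spare := fun u hu => ?_
      count := ⟨q, d, hc, ?_, ?_⟩ }
    · simp only [State.openSingle, List.length_take, length_insertBy]; omega
    · simp only [State.openSingle, List.length_drop, length_insertBy]; omega
    · have hg : s.gain < π.target := by
        by_contra hg
        have : π.target - s.gain = 0 := by omega
        simp [State.openSingle, this] at hu
      rcases mem_insertBy.1 (List.mem_of_mem_take hu) with rfl | hu
      · exact ⟨hx, le_rfl, by simpa [Bin.level] using hlev hg⟩
      · exact h.mem_singles u hu
    · rcases mem_insertBy.1 (List.mem_of_mem_drop hu) with rfl | hu
      · exact ⟨hx, le_rfl⟩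
      · exact ⟨(h.mem_singles u hu).1, (h.mem_singles u hu).2.1⟩
    · simp only [State.openSingle, isLarge, if_pos hx, List.length_take, List.length_drop,
        length_insertBy, List.length_nil] at hL ⊢
      omega
    · simpa only [State.openSingle, smallSize, if_pos hx, add_zero] using hS
  | coverSingle u us hx hu hb hc' =>
    have h1 := h.singles_le
    have h2 := h.singles_sorted
    have h3 := h.mem_singles
    have h4 := h.le_waiting
    have hx' : ¬ 1 / 2 ≤ x := by linarith
    rw [hu] at h1 h2 h3 hL
    simp only [List.length_cons] at h1 hL
    refine { h with
      le_waiting := by simp only [State.coverSingle]; omega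
      singles_le := by simp only [State.coverSingle]; omega
      singles_sorted := h2.of_cons
      mem_singles := fun v hv => h3 v (List.mem_cons_of_mem _ hv)
      used_le := by simp only [State.coverSingle]; linarith
      count := ⟨q, d, ?_, ?_, ?_⟩ }
    · simp only [State.coverSingle]; omega
    · simp only [State.coverSingle, isLarge, if_neg hx'] at hL ⊢; omega
    · simp only [State.coverSingle, smallSize, if_neg hx']; linarith
  | fillWaiting p ps hx hp hw hc' =>
    have h1 := h.waiting_le
    have h2 := h.le_waiting
    have h4 := h.waiting_sorted
    have h5 := h.mem_waiting
    have hx' : ¬ 1 / 2 ≤ x := by linarith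
    rw [hp] at h1 h2 h4 h5 hS
    simp only [List.length_cons] at h1 h2 hS
    have hpf := h5 p (by simp)
    have hpT := hT _ _ hw
    refine { h with
      waiting_le := by simp only [State.fillWaiting, length_insertBy]; omega
      le_waiting := by simp only [State.fillWaiting, length_insertBy]; omega
      waiting_sorted := pairwise_insertBy _ _ h4.of_cons
      mem_waiting := fun p' hp' => ?_
      count := ⟨q, d, hc, ?_, ?_⟩ }
    · rcases mem_insertBy.1 hp' with rfl | hp'
      · exact ⟨hpf.1, by simp only; linarith, by simp only; linarith⟩
      · exact h5 p' (List.mem_cons_of_mem _ hp')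
    · simp only [State.fillWaiting, isLarge, if_neg hx']; omega
    · simp only [State.fillWaiting, smallSize, if_neg hx', length_insertBy, sum_map_insertBy,
        List.map_cons, List.sum_cons] at hS ⊢
      linarith
  | fillSingle u us hx hu hb hc' hw =>
    have h1 := h.singles_le
    have h2 := h.singles_sorted
    have h3 := h.mem_singles
    have hx' : ¬ 1 / 2 ≤ x := by linarith
    rw [hu] at h1 h2 h3 hL
    simp only [List.length_cons] at h1 hL
    have hu3 := h3 u (by simp)
    refine { h with
      singles_le := by simp only [State.fillSingle, List.length_cons]; omega
      singles_sorted := by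
        rw [List.pairwise_cons] at h2
        exact List.pairwise_cons.2 ⟨h2.1, h2.2⟩
      mem_singles := fun v hv => ?_
      used_le := by simp only [State.fillSingle]; linarith
      count := ⟨q, d, hc, ?_, ?_⟩ }
    · rcases List.mem_cons.1 hv with rfl | hv
      · refine ⟨hu3.1, by simp only; linarith, ?_⟩
        unfold Bin.level at hc' ⊢
        simp only
        linarith
      · exact h3 v (List.mem_cons_of_mem _ hv)
    · simp only [State.fillSingle, isLarge, if_neg hx', List.length_cons]; omega
    · simp only [State.fillSingle, smallSize, if_neg hx']; linarith
  | fillCurrent hx hw hc' =>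
    have h6 := h.current_big
    have h7 := h.current_nonneg
    unfold Bin.level at hc'
    have hx' : ¬ 1 / 2 ≤ x := by linarith
    refine { h with
      current_nonneg := by simp only [State.fillCurrent]; linarith
      current_lt := by simp only [State.fillCurrent]; linarith
      count := ⟨q, d, hc, ?_, ?_⟩ }
    · simp only [State.fillCurrent, isLarge, if_neg hx']; omega
    · simp only [State.fillCurrent, smallSize, if_neg hx']; linarith
  | coverCurrent hx hw hc' =>
    have h8 := h.current_lt
    have hx' : ¬ 1 / 2 ≤ x := by linarith
    refine { h with
      current_big := rfl
      current_nonneg := le_rfl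
      current_lt := zero_lt_one
      count := ⟨q, d + 1, ?_, ?_, ?_⟩ }
    · simp only [State.coverCurrent]; omega
    · simp only [State.coverCurrent, isLarge, if_neg hx']; omega
    · simp only [State.coverCurrent, smallSize, if_neg hx', Nat.cast_add, Nat.cast_one]; linarith

theorem ledger_run {π : Params} {T : ℝ} (hT0 : 0 ≤ T) (hb : 0 ≤ π.budget)
    (hT : ∀ y l, π.wants y l → l < T) (σ : List ℝ) (hσ : IsInput σ) :
    Ledger π T (State.run π σ) (total isLarge σ) (total smallSize σ) := by
  induction σ using List.reverseRecOn with
  | nil => exact ledger_init hT0 hb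
  | append_singleton σ x ih =>
    rw [State.run_append_singleton, total_append_singleton, total_append_singleton]
    exact (ih fun y hy => hσ y (by simp [hy])).move hT (hσ x (by simp)).1 (move_step _ _ _)

/-- The packing covers at least as many bins as the algorithm counts. -/
theorem covered_run_le {π : Params} {T : ℝ} (hT0 : 0 ≤ T) (hb : 0 ≤ π.budget)
    (hT : ∀ y l, π.wants y l → l < T) (σ : List ℝ) (hσ : IsInput σ) :
    (State.run π σ).covered ≤
      coveredBins σ fun i => (State.run π (σ.take ((i : ℕ) + 1))).last := by
  suffices h : ∃ C : Finset ℕ, C.card = (State.run π σ).covered ∧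
      Tracks (level σ fun i => (State.run π (σ.take ((i : ℕ) + 1))).last) C
        (State.run π σ).bins (State.run π σ).fresh by
    obtain ⟨C, hC, ht⟩ := h
    exact hC ▸ card_le_coveredBins fun i hi => (ht.covered i hi).2
  induction σ using List.reverseRecOn with
  | nil =>
    refine ⟨∅, rfl, ?_⟩
    have e : (level [] fun i => (State.run π (List.take ((i : ℕ) + 1) [])).last) = fun _ => 0 := by
      funext i
      simp [level]
    rw [e]
    exact tracks_init π.target
  | append_singleton σ x ih =>
    have hσ' : IsInput σ := fun y hy => hσ y (by simp [hy])
    obtain ⟨C, hC, ht⟩ := ih hσ'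
    have hl := ledger_run hT0 hb hT σ hσ'
    rw [level_append_singleton fun τ => (State.run π τ).last, State.run_append_singleton]
    refine (move_step π (State.run π σ) x).tracks (fun p hp => (hl.mem_waiting p hp).1)
      (fun w hw => ?_) hC ht
    have := hl.mem_spare w hw
    unfold Bin.level
    linarith

/-! ### The number of good items among the single large items -/

/-- The indicator of the good sizes for the threshold `ξ`: small items of total size `ξ` are enough
to cover a bin with such an item. -/
def isGood (ξ x : ℝ) : ℕ := open Classical in if 1 - ξ ≤ x then 1 else 0

/-- The number of bins with a good large item. -/
def goodCount (ξ : ℝ) (l : List Bin) : ℕ := (l.map fun u => isGood ξ u.big).sum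

theorem goodCount_cons (ξ : ℝ) (u : Bin) (l : List Bin) :
    goodCount ξ (u :: l) = isGood ξ u.big + goodCount ξ l := by
  simp [goodCount]

theorem goodCount_insertBy (ξ : ℝ) (key : Bin → ℝ) (u : Bin) (l : List Bin) :
    goodCount ξ (insertBy key u l) = isGood ξ u.big + goodCount ξ l := by
  rw [goodCount, ((insertBy_perm key u l).map _).sum_eq, ← goodCount, goodCount_cons]

theorem goodCount_eq_zero {ξ : ℝ} {l : List Bin} :
    goodCount ξ l = 0 ↔ ∀ u ∈ l, u.big < 1 - ξ := by
  simp [goodCount, List.sum_eq_zero_iff, isGood, -tsub_le_iff_right]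

theorem goodCount_take_add_drop (ξ : ℝ) (l : List Bin) (c : ℕ) :
    goodCount ξ (l.take c) + goodCount ξ (l.drop c) = goodCount ξ l := by
  rw [goodCount, goodCount, goodCount, ← List.sum_append, ← List.map_append, List.take_append_drop]

theorem goodCount_take (ξ : ℝ) {l : List Bin} (h : l.Pairwise fun a c => a.rank ≤ c.rank) (c : ℕ) :
    goodCount ξ (l.take c) = min c (goodCount ξ l) := by
  induction l generalizing c with
  | nil => simp [goodCount]
  | cons u l ih =>
    cases c with
    | zero => simp [goodCount]
    | succ c =>
      rw [List.take_succ_cons, goodCount_cons, goodCount_cons, ih h.of_cons]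
      by_cases hu : 1 - ξ ≤ u.big
      · simp only [isGood, if_pos hu]
        omega
      · have h0 : goodCount ξ l = 0 := by
          refine goodCount_eq_zero.2 fun v hv => ?_
          have := (List.pairwise_cons.1 h).1 v hv
          unfold Bin.rank at this
          linarith [not_le.1 hu]
        simp [isGood, if_neg hu, h0, -tsub_le_iff_right]

/-- After `L` large items, `G` of them good, either every pair of large items has a bad item, which
bounds `G`, or all single large items are good, and they suffice to reach the target. -/
def Balanced (π : Params) (ξ : ℝ) (s : State) (L G : ℕ) : Prop :=
  (goodCount ξ s.spare = 0 ∧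
    2 * G + s.singles.length + s.spare.length ≤ L + s.gain + 2 * goodCount ξ s.singles) ∨
  π.target ≤ s.gain + goodCount ξ s.singles

theorem isGood_of_lt {ξ x : ℝ} (hξ : ξ ≤ 1 / 2) (hx : x < 1 / 2) : isGood ξ x = 0 := by
  unfold isGood
  rw [if_neg]
  linarith

theorem isGood_le_one (ξ x : ℝ) : isGood ξ x ≤ 1 := by
  unfold isGood
  split_ifs <;> simp

/-- Since `singles` is sorted, a good bin leaves it for `spare` only if all bins that remain are good
and their number is what is missing for the target. -/
theorem Balanced.move {π : Params} {T ξ : ℝ} {s t : State} {L G : ℕ} {S x : ℝ}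
    (hξ : ξ ≤ 1 / 2) (h : Ledger π T s L S) (hB : Balanced π ξ s L G) (hm : Move π s x t) :
    Balanced π ξ t (L + isLarge x) (G + isGood ξ x) := by
  have hle := h.singles_le
  have hx1 := isGood_le_one ξ x
  unfold Balanced at hB ⊢
  cases hm with
  | coverSpare w ws hx hw =>
    rw [hw, goodCount_cons, List.length_cons] at hB
    simp only [State.coverSpare, isLarge, if_pos hx]
    omega
  | coverWaiting p ps hx hw hp hg hc =>
    have h1 := goodCount_take ξ h.singles_sorted (π.target - (s.gain + 1))
    have h2 := goodCount_take_add_drop ξ s.singles (π.target - (s.gain + 1))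
    rw [hw] at hB
    simp only [State.coverWaiting, isLarge, if_pos hx, List.length_take, List.length_drop,
      List.length_nil] at hB ⊢
    omega
  | openSingle hx hw hc =>
    have h1 := goodCount_take ξ (pairwise_insertBy Bin.rank ⟨s.fresh, x, 0⟩ h.singles_sorted)
      (π.target - s.gain)
    have h2 := goodCount_take_add_drop ξ (insertBy Bin.rank ⟨s.fresh, x, 0⟩ s.singles)
      (π.target - s.gain)
    rw [goodCount_insertBy] at h1 h2
    rw [hw] at hB
    simp only [State.openSingle, isLarge, if_pos hx, List.length_take, List.length_drop,
      List.length_nil, length_insertBy] at hB h1 h2 ⊢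
    omega
  | coverSingle u us hx hu hb hc =>
    have h3 := isGood_le_one ξ u.big
    have hx' : x < 1 / 2 := by linarith
    rw [hu, goodCount_cons] at hB
    simp only [State.coverSingle, isLarge, if_neg hx'.not_ge, isGood_of_lt hξ hx',
      List.length_cons] at hB ⊢
    omega
  | fillWaiting p ps hx hp hw hc =>
    have hx' : x < 1 / 2 := by linarith
    simpa only [State.fillWaiting, isLarge, if_neg hx'.not_ge, isGood_of_lt hξ hx', add_zero]
      using hB
  | fillSingle u us hx hu hb hc hw =>
    have hx' : x < 1 / 2 := by linarith
    rw [hu, goodCount_cons] at hB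
    simpa only [State.fillSingle, isLarge, if_neg hx'.not_ge, isGood_of_lt hξ hx', add_zero,
      goodCount_cons, List.length_cons] using hB
  | fillCurrent hx hw hc =>
    simpa only [State.fillCurrent, isLarge, if_neg hx.not_ge, isGood_of_lt hξ hx, add_zero]
      using hB
  | coverCurrent hx hw hc =>
    simpa only [State.coverCurrent, isLarge, if_neg hx.not_ge, isGood_of_lt hξ hx, add_zero]
      using hB

/-! ### The small items -/

/-- The relation between the parameters of the algorithm and the threshold `ξ` for good items. The
waiting bins are to be filled up to the level `ζ`, and small items of size at most `τ` are
negligible. -/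
structure Fits (π : Params) (T ξ ζ τ : ℝ) : Prop where
  nonneg : 0 ≤ ξ
  le_half : ξ ≤ 1 / 2
  le_level : ξ ≤ ζ
  level_le : ζ ≤ T
  wants_lt : ∀ y l, π.wants y l → l < T
  wants : ∀ y l, τ < y → 0 ≤ l → l < ζ → π.wants y l
  not_wants : ∀ y l, y ≤ ζ → ζ ≤ l → ¬ π.wants y l
  budget_eq : π.budget = π.target * (T + 1 / 10) + 1

/-- All waiting bins have level at least `ζ`, so that every good item covers each of them. -/
def Filled (ζ : ℝ) (s : State) : Prop := ∀ p ∈ s.waiting, ζ ≤ p.fill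

/-- The target is reached, or all waiting bins are filled and no single item is good. In the latter
case no good item becomes a single item any more, so that the condition persists. -/
def Settled (π : Params) (ξ ζ : ℝ) (s : State) : Prop :=
  s.gain = π.target ∨ Filled ζ s ∧ ∀ u ∈ s.singles, u.big < 1 - ξ

theorem Filled.move {π : Params} {ζ x : ℝ} {s t : State} (hx : 0 < x) (h : Filled ζ s)
    (hm : Move π s x t) : Filled ζ t := by
  cases hm with
  | coverWaiting p ps _ _ hp =>
    exact fun q hq => h q (by rw [hp]; exact List.mem_cons_of_mem _ hq)
  | fillWaiting p ps _ hp =>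
    intro q hq
    rcases mem_insertBy.1 hq with rfl | hq
    · have := h p (by simp [hp])
      simp only
      linarith
    · exact h q (by rw [hp]; exact List.mem_cons_of_mem _ hq)
  | _ => exact h

/-- When all waiting bins are filled, only bad items open a bin. -/
theorem lt_of_filled {π : Params} {T ξ ζ x : ℝ} {s : State} {L : ℕ} {S : ℝ}
    (hζ : ξ ≤ ζ) (h : Ledger π T s L S) (hf : Filled ζ s) (hg : s.gain < π.target)
    (hc : ∀ p ps, s.waiting = p :: ps → p.fill + x < 1) : x < 1 - ξ := by
  have h2 := h.le_waiting
  cases hp : s.waiting with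
  | nil => rw [hp, List.length_nil] at h2; omega
  | cons p ps =>
    have := hc p ps hp
    have := hf p (by simp [hp])
    linarith

theorem Settled.move {π : Params} {T ξ ζ x : ℝ} {s t : State} {L : ℕ} {S : ℝ} (hx : 0 < x)
    (hζ : ξ ≤ ζ) (h : Ledger π T s L S) (ht : t.singles.length + t.gain ≤ π.target)
    (hs : Settled π ξ ζ s) (hm : Move π s x t) : Settled π ξ ζ t := by
  have hle := h.singles_le
  rcases hs with hs | ⟨hf, hb⟩
  · left
    cases hm with
    | coverWaiting p ps _ _ _ hg => omega
    | coverSingle u us _ hu => rw [hu, List.length_cons] at hle; omega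
    | _ => exact hs
  · by_cases hg : s.gain = π.target
    · left
      cases hm with
      | coverWaiting p ps _ _ _ hg => omega
      | coverSingle u us _ hu => rw [hu, List.length_cons] at hle; omega
      | _ => exact hg
    refine Or.inr ⟨hf.move hx hm, ?_⟩
    cases hm with
    | coverWaiting p ps => exact fun u hu => hb u (List.mem_of_mem_take hu)
    | openSingle hx' hw hc =>
      intro u hu
      rcases mem_insertBy.1 (List.mem_of_mem_take hu) with rfl | hu
      · exact lt_of_filled hζ h hf (by omega) (hc (by omega))
      · exact hb u hu
    | coverSingle u us _ hu =>
      exact fun v hv => hb v (by rw [hu]; exact List.mem_cons_of_mem _ hv)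
    | fillSingle u us _ hu =>
      intro v hv
      rcases List.mem_cons.1 hv with rfl | hv
      · exact hb u (by simp [hu])
      · exact hb v (by rw [hu]; exact List.mem_cons_of_mem _ hv)
    | _ => exact hb

/-- The total size of the small items in the first bin of a list. -/
def headFill : List Bin → ℝ
  | [] => 0
  | u :: _ => u.fill

/-- The fill of the first single bin, once all waiting bins are filled. -/
def openFill (ζ : ℝ) (s : State) : ℝ :=
  open Classical in if Filled ζ s then headFill s.singles else 0

/-- The size of a relevant small item, capped at `ξ`. -/
def cappedSize (ξ τ x : ℝ) : ℝ := open Classical in if τ < x ∧ x ≤ 1 / 10 then min x ξ else 0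

/-- The size of a negligible item. -/
def tinySize (τ x : ℝ) : ℝ := open Classical in if x ≤ τ then x else 0

/-- No relevant small item was wasted: `M` is the total capped size of the relevant small items, and
`N` the total size of the negligible ones. A waiting bin accounts for at most `ζ + ξ`, and a bin
that was covered by a small item for at most `2 * ξ`. -/
structure Thrifty (π : Params) (ξ ζ : ℝ) (s : State) (M N : ℝ) : Prop where
  capped_le : M ≤ (π.target - s.waiting.length) * (ζ + ξ) +
    (s.waiting.map fun p => min p.fill (ζ + ξ)).sum + s.gain * (2 * ξ) + openFill ζ s
  used_le : s.used ≤ N + s.gain * (1 / 10 + ξ) + openFill ζ s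

theorem headFill_nonneg {l : List Bin} (h : ∀ u ∈ l, 0 ≤ u.fill) : 0 ≤ headFill l := by
  cases l with
  | nil => exact le_rfl
  | cons u l => exact h u (by simp)

theorem openFill_nonneg {π : Params} {T ζ : ℝ} {s : State} {L : ℕ} {S : ℝ}
    (h : Ledger π T s L S) : 0 ≤ openFill ζ s := by
  unfold openFill
  split_ifs
  · exact headFill_nonneg fun u hu => (h.mem_singles u hu).2.1
  · exact le_rfl

/-- Before the algorithm is settled, the first single bin is good once the waiting bins are
filled. -/
theorem exists_good_head {π : Params} {T ξ ζ : ℝ} {s : State} {L : ℕ} {S : ℝ}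
    (h : Ledger π T s L S) (hs : ¬ Settled π ξ ζ s) (hf : Filled ζ s) :
    ∃ u us, s.singles = u :: us ∧ 1 - ξ ≤ u.big ∧ 0 ≤ u.fill ∧ u.fill < ξ := by
  have hb : ¬ ∀ u ∈ s.singles, u.big < 1 - ξ := fun hb => hs (Or.inr ⟨hf, hb⟩)
  push Not at hb
  obtain ⟨v, hv, hvb⟩ := hb
  have hsort := h.singles_sorted
  have hmem := h.mem_singles
  cases hu : s.singles with
  | nil => rw [hu] at hv; simp at hv
  | cons u us =>
    rw [hu] at hv hsort hmem
    have hub : v.big ≤ u.big := by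
      rcases List.mem_cons.1 hv with rfl | hv
      · exact le_rfl
      · have := (List.pairwise_cons.1 hsort).1 v hv
        unfold Bin.rank at this
        linarith
    have := hmem u (by simp)
    unfold Bin.level at this
    exact ⟨u, us, rfl, hvb.trans hub, this.2.1, by linarith⟩

theorem cappedSize_le {ξ τ x : ℝ} (hξ : 0 ≤ ξ) : cappedSize ξ τ x ≤ ξ := by
  unfold cappedSize
  split_ifs
  · exact min_le_right _ _
  · exact hξ

theorem cappedSize_le_self {ξ τ x : ℝ} (hx : 0 ≤ x) : cappedSize ξ τ x ≤ x := by
  unfold cappedSize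
  split_ifs
  · exact min_le_left _ _
  · exact hx

theorem cappedSize_of_lt {ξ τ x : ℝ} (hx : 1 / 10 < x) : cappedSize ξ τ x = 0 := by
  unfold cappedSize
  exact if_neg fun h => absurd h.2 (not_le.2 hx)

theorem cappedSize_of_le {ξ τ x : ℝ} (hx : x ≤ τ) : cappedSize ξ τ x = 0 := by
  unfold cappedSize
  exact if_neg fun h => absurd h.1 (not_lt.2 hx)

theorem tinySize_nonneg {τ x : ℝ} (hx : 0 ≤ x) : 0 ≤ tinySize τ x := by
  unfold tinySize
  split_ifs
  · exact hx
  · exact le_rfl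

theorem tinySize_of_le {τ x : ℝ} (hx : x ≤ τ) : tinySize τ x = x := if_pos hx

theorem add_cappedSize_le_min {ξ τ ζ x y : ℝ} (hx : 0 ≤ x) (hξ : 0 ≤ ξ) (hy : y ≤ ζ) :
    min y (ζ + ξ) + cappedSize ξ τ x ≤ min (y + x) (ζ + ξ) := by
  have h1 := cappedSize_le (τ := τ) (x := x) hξ
  have h2 := cappedSize_le_self (ξ := ξ) (τ := τ) hx
  refine le_min ?_ ?_
  · linarith [min_le_left y (ζ + ξ)]
  · linarith [min_le_left y (ζ + ξ)]

theorem headFill_take (l : List Bin) {c : ℕ} (hc : c ≠ 0) : headFill (l.take c) = headFill l := by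
  obtain ⟨c, rfl⟩ := Nat.exists_eq_succ_of_ne_zero hc
  cases l <;> rfl

/-- As long as some waiting bin is not filled, it receives every relevant small item that does not
cover a bin at once. -/
theorem Thrifty.move_of_not_filled {π : Params} {T ξ ζ τ : ℝ} {s t : State} {L : ℕ} {S M N x : ℝ}
    (hF : Fits π T ξ ζ τ) (hx0 : 0 < x) (h : Ledger π T s L S)
    (hf : ¬ Filled ζ s) (hT : Thrifty π ξ ζ s M N) (hm : Move π s x t) :
    Thrifty π ξ ζ t (M + cappedSize ξ τ x) (N + tinySize τ x) := by
  have ht := openFill_nonneg (ζ := ζ) (h.move hF.wants_lt hx0 hm)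
  have hs0 : openFill ζ s = 0 := if_neg hf
  obtain ⟨h1, h2⟩ := hT
  rw [hs0] at h1 h2
  have hξ := hF.nonneg
  have hc1 := cappedSize_le (τ := τ) (x := x) hξ
  have ht0 := tinySize_nonneg (τ := τ) hx0.le
  have hhead : ∃ p ps, s.waiting = p :: ps ∧ 0 ≤ p.fill ∧ p.fill < ζ := by
    unfold Filled at hf
    push Not at hf
    obtain ⟨q, hq, hqζ⟩ := hf
    have hsort := h.waiting_sorted
    have hmem := h.mem_waiting
    cases hp : s.waiting with
    | nil => rw [hp] at hq; simp at hq
    | cons p ps =>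
      rw [hp] at hq hsort hmem
      refine ⟨p, ps, rfl, (hmem p (by simp)).2.1, ?_⟩
      rcases List.mem_cons.1 hq with rfl | hq
      · exact hqζ
      · exact ((List.pairwise_cons.1 hsort).1 q hq).trans_lt hqζ
  obtain ⟨p, ps, hp, hp0, hpζ⟩ := hhead
  -- a relevant item that is wanted by the first waiting bin cannot go elsewhere
  have hwant : x ≤ 1 / 10 → ¬ π.wants x p.fill → cappedSize ξ τ x = 0 ∧ tinySize τ x = x := by
    intro hx hw
    have hxτ : x ≤ τ := by
      by_contra hτ
      exact hw (hF.wants x p.fill (not_le.1 hτ) hp0 hpζ)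
    exact ⟨cappedSize_of_le hxτ, tinySize_of_le hxτ⟩
  have hcur : (x ≤ 1 / 10 → (∀ p ps, s.waiting = p :: ps → ¬ π.wants x p.fill) ∧
      (∀ u us, s.singles = u :: us → π.budget < s.used)) → cappedSize ξ τ x = 0 := by
    intro hw
    by_cases hx : x ≤ 1 / 10
    · exact (hwant hx ((hw hx).1 p ps hp)).1
    · exact cappedSize_of_lt (not_le.1 hx)
  cases hm with
  | coverSpare w ws hx hw =>
    rw [cappedSize_of_lt (by linarith)]
    constructor <;> simp only [State.coverSpare] at ht ⊢ <;> linarith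
  | coverWaiting p' ps' hx hw hp' hg hc =>
    rw [cappedSize_of_lt (by linarith)]
    rw [hp'] at h1
    have := min_le_right p'.fill (ζ + ξ)
    constructor <;> simp only [State.coverWaiting, List.map_cons, List.sum_cons, List.length_cons,
      Nat.cast_add, Nat.cast_one] at ht h1 h2 ⊢ <;> linarith
  | openSingle hx hw hc =>
    rw [cappedSize_of_lt (by linarith)]
    constructor <;> simp only [State.openSingle] at ht ⊢ <;> linarith
  | coverSingle u us hx hu hb hc =>
    constructor <;> simp only [State.coverSingle, Nat.cast_add, Nat.cast_one] at ht ⊢ <;> linarith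
  | fillWaiting p' ps' hx hp' hw hc =>
    rw [hp] at hp'
    cases hp'
    have := add_cappedSize_le_min (ξ := ξ) (τ := τ) hx0.le hξ hpζ.le
    rw [hp] at h1
    constructor <;> simp only [State.fillWaiting, List.map_cons, List.sum_cons, List.length_cons,
      length_insertBy, sum_map_insertBy] at ht h1 h2 ⊢ <;> linarith
  | fillSingle u us hx hu hb hc hw =>
    obtain ⟨e1, e2⟩ := hwant hx (hw p ps hp)
    rw [e1, e2]
    constructor <;> simp only [State.fillSingle] at ht ⊢ <;> linarith
  | fillCurrent hx hw hc =>
    rw [hcur hw]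
    constructor <;> simp only [State.fillCurrent] at ht ⊢ <;> linarith
  | coverCurrent hx hw hc =>
    rw [hcur hw]
    constructor <;> simp only [State.coverCurrent] at ht ⊢ <;> linarith

/-- Once all waiting bins are filled, every relevant small item goes to the first single bin, which
is good and therefore covered by small items of total size `ξ`. -/
theorem Thrifty.move_of_filled {π : Params} {T ξ ζ τ : ℝ} {s t : State} {L : ℕ} {S M N x : ℝ}
    (hF : Fits π T ξ ζ τ) (hx0 : 0 < x) (h : Ledger π T s L S) (hs : ¬ Settled π ξ ζ s)
    (hN : N ≤ 1) (hf : Filled ζ s) (hT : Thrifty π ξ ζ s M N) (hm : Move π s x t) :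
    Thrifty π ξ ζ t (M + cappedSize ξ τ x) (N + tinySize τ x) := by
  have ht := openFill_nonneg (ζ := ζ) (h.move hF.wants_lt hx0 hm)
  obtain ⟨u, us, hu, hug, hu0, huξ⟩ := exists_good_head h hs hf
  have hst : openFill ζ t = headFill t.singles := if_pos (hf.move hx0 hm)
  have hs0 : openFill ζ s = u.fill := (if_pos hf).trans (by rw [hu]; rfl)
  have hle := h.singles_le
  have hgain : s.gain < π.target := by
    have : s.gain ≠ π.target := fun h => hs (Or.inl h)
    omega
  obtain ⟨h1, h2⟩ := hT
  rw [hs0] at h1 h2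
  have hξ := hF.nonneg
  have hξζ := hF.le_level
  have hc1 := cappedSize_le (τ := τ) (x := x) hξ
  have hc2 := cappedSize_le_self (ξ := ξ) (τ := τ) hx0.le
  have ht0 := tinySize_nonneg (τ := τ) hx0.le
  have hb : s.used ≤ π.budget := by
    have hk : (s.gain : ℝ) + 1 ≤ π.target := by exact_mod_cast hgain
    have hζT := hF.level_le
    have hg0 : (0 : ℝ) ≤ s.gain := Nat.cast_nonneg _
    have e1 : (s.gain : ℝ) * (1 / 10 + ξ) ≤ s.gain * (T + 1 / 10) :=
      mul_le_mul_of_nonneg_left (by linarith) hg0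
    have e2 : ((s.gain : ℝ) + 1) * (T + 1 / 10) ≤ π.target * (T + 1 / 10) :=
      mul_le_mul_of_nonneg_right hk (by linarith)
    rw [hF.budget_eq]
    linarith
  -- an item that does not cover the first single bin is too small for the waiting bins
  have hsmall : u.level + x < 1 → x ≤ ζ := by
    intro hlt
    unfold Bin.level at hlt
    linarith
  have hcur : (x ≤ 1 / 10 → (∀ p ps, s.waiting = p :: ps → ¬ π.wants x p.fill) ∧
      (∀ u us, s.singles = u :: us → π.budget < s.used)) → cappedSize ξ τ x = 0 := by
    intro hw
    by_cases hx : x ≤ 1 / 10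
    · exact absurd ((hw hx).2 u us hu) (not_lt.2 hb)
    · exact cappedSize_of_lt (not_le.1 hx)
  cases hm with
  | coverSpare w ws hx hw =>
    rw [cappedSize_of_lt (by linarith)]
    have e : headFill s.singles = u.fill := by rw [hu]; rfl
    constructor <;> simp only [State.coverSpare] at hst ⊢ <;> linarith
  | coverWaiting p' ps' hx hw hp' hg hc =>
    rw [cappedSize_of_lt (by linarith)]
    rw [hp'] at h1
    have := min_le_right p'.fill (ζ + ξ)
    constructor <;> simp only [State.coverWaiting, List.map_cons, List.sum_cons, List.length_cons,
      Nat.cast_add, Nat.cast_one] at ht h1 h2 ⊢ <;> linarith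
  | openSingle hx hw hc =>
    rw [cappedSize_of_lt (by linarith)]
    have hbad := lt_of_filled hξζ h hf hgain (hc hgain)
    have e : headFill (s.openSingle (π.target - s.gain) x).singles = u.fill := by
      simp only [State.openSingle]
      rw [headFill_take _ (by omega), hu, insertBy_cons_of_lt]
      · rfl
      · simp only [Bin.rank]
        linarith
    rw [e] at hst
    constructor <;> simp only [State.openSingle] at hst ⊢ <;> linarith
  | coverSingle u' us' hx hu' hb hc =>
    constructor <;> simp only [State.coverSingle, Nat.cast_add, Nat.cast_one] at ht ⊢ <;> linarith
  | fillWaiting p ps hx hp hw hc =>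
    exact absurd hw (hF.not_wants x p.fill (hsmall (hc u us hu hb)) (hf p (by simp [hp])))
  | fillSingle u' us' hx hu' hb hc hw =>
    rw [hu] at hu'
    cases hu'
    have e : headFill (s.fillSingle x u us).singles = u.fill + x := rfl
    rw [e] at hst
    constructor <;> simp only [State.fillSingle] at hst ⊢ <;> linarith
  | fillCurrent hx hw hc =>
    rw [hcur hw]
    have e : headFill s.singles = u.fill := by rw [hu]; rfl
    constructor <;> simp only [State.fillCurrent] at hst ⊢ <;> linarith
  | coverCurrent hx hw hc =>
    rw [hcur hw]
    have e : headFill s.singles = u.fill := by rw [hu]; rfl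
    constructor <;> simp only [State.coverCurrent] at hst ⊢ <;> linarith

/-! ### The target is reached -/

theorem balanced_run {π : Params} {T ξ ζ τ : ℝ} (hT0 : 0 ≤ T) (hb : 0 ≤ π.budget)
    (hF : Fits π T ξ ζ τ) (σ : List ℝ) (hσ : IsInput σ) :
    Balanced π ξ (State.run π σ) (total isLarge σ) (total (isGood ξ) σ) := by
  induction σ using List.reverseRecOn with
  | nil => exact Or.inl ⟨rfl, le_rfl⟩
  | append_singleton σ x ih =>
    have hσ' : IsInput σ := fun y hy => hσ y (by simp [hy])
    rw [State.run_append_singleton, total_append_singleton, total_append_singleton]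
    exact Balanced.move hF.le_half (ledger_run hT0 hb hF.wants_lt σ hσ') (ih hσ') (move_step _ _ _)

theorem settled_append_singleton {π : Params} {T ξ ζ τ : ℝ} (hT0 : 0 ≤ T) (hb : 0 ≤ π.budget)
    (hF : Fits π T ξ ζ τ) {σ : List ℝ} {x : ℝ} (hσ : IsInput (σ ++ [x]))
    (h : Settled π ξ ζ (State.run π σ)) : Settled π ξ ζ (State.run π (σ ++ [x])) := by
  have h1 := (ledger_run hT0 hb hF.wants_lt _ hσ).singles_le
  rw [State.run_append_singleton] at h1 ⊢
  exact h.move (hσ x (by simp)).1 hF.le_level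
    (ledger_run hT0 hb hF.wants_lt σ fun y hy => hσ y (by simp [hy])) h1 (move_step _ _ _)

theorem total_tinySize_le {τ : ℝ} (hτ : 0 ≤ τ) (σ : List ℝ) :
    total (tinySize τ) σ ≤ σ.length * τ := by
  have h : ∀ x ∈ σ.map (tinySize τ), x ≤ τ := by
    intro x hx
    obtain ⟨y, _, rfl⟩ := List.mem_map.1 hx
    unfold tinySize
    split_ifs with hy
    · exact hy
    · exact hτ
  simpa [total] using List.sum_le_card_nsmul _ _ h

theorem settled_or_thrifty_run {π : Params} {T ξ ζ τ : ℝ} (hT0 : 0 ≤ T) (hb : 0 ≤ π.budget)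
    (hF : Fits π T ξ ζ τ) (hτ : 0 ≤ τ) (σ : List ℝ) (hσ : IsInput σ) (hn : σ.length * τ ≤ 1) :
    Settled π ξ ζ (State.run π σ) ∨
      Thrifty π ξ ζ (State.run π σ) (total (cappedSize ξ τ) σ) (total (tinySize τ) σ) := by
  induction σ using List.reverseRecOn with
  | nil =>
    right
    have h0 := openFill_nonneg (ζ := ζ) (ledger_init hT0 hb)
    have hξ := hF.nonneg
    have hζ := hF.le_level
    refine ⟨?_, ?_⟩
    · have : (((State.run π []).waiting.map fun p => min p.fill (ζ + ξ)).sum) = 0 := by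
        simp [State.run, State.init, Function.comp_def, hξ.trans hζ, add_nonneg, hξ]
      rw [this]
      simpa [total, State.run, State.init] using h0
    · simpa [total, State.run, State.init] using h0
  | append_singleton σ x ih =>
    have hσ' : IsInput σ := fun y hy => hσ y (by simp [hy])
    have hn' : σ.length * τ ≤ 1 := by
      rw [List.length_append, Nat.cast_add] at hn
      have : (0 : ℝ) ≤ ([x] : List ℝ).length * τ := mul_nonneg (Nat.cast_nonneg _) hτ
      linarith
    by_cases hs : Settled π ξ ζ (State.run π σ)
    · exact Or.inl (settled_append_singleton hT0 hb hF hσ hs)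
    right
    have ih' := (ih hσ' hn').resolve_left hs
    have hl := ledger_run hT0 hb hF.wants_lt σ hσ'
    have hx := (hσ x (by simp)).1
    rw [State.run_append_singleton, total_append_singleton, total_append_singleton]
    by_cases hf : Filled ζ (State.run π σ)
    · exact ih'.move_of_filled hF hx hl hs ((total_tinySize_le hτ σ).trans hn') hf (move_step _ _ _)
    · exact ih'.move_of_not_filled hF hx hl hf (move_step _ _ _)

theorem settled_run_of_eq_zero {π : Params} {T ξ ζ τ : ℝ} (hT0 : 0 ≤ T) (hb : 0 ≤ π.budget)
    (hF : Fits π T ξ ζ τ) (hζ : ζ = 0) (σ : List ℝ) (hσ : IsInput σ) :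
    Settled π ξ ζ (State.run π σ) := by
  induction σ using List.reverseRecOn with
  | nil =>
    refine Or.inr ⟨fun p hp => ?_, by simp [State.run, State.init]⟩
    rw [hζ]
    exact ((ledger_init hT0 hb).mem_waiting p hp).2.1
  | append_singleton σ x ih =>
    exact settled_append_singleton hT0 hb hF hσ (ih fun y hy => hσ y (by simp [hy]))

/-- The algorithm covers as many bins with a single large item as it aims for, if more than half of
the large items are good and there are enough relevant small items. -/
theorem gain_run_eq {π : Params} {T ξ ζ τ : ℝ} (hT0 : 0 ≤ T) (hb : 0 ≤ π.budget)
    (hF : Fits π T ξ ζ τ) (hτ : 0 ≤ τ) (σ : List ℝ) (hσ : IsInput σ) (hn : σ.length * τ ≤ 1)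
    (hgood : total isLarge σ + π.target ≤ 2 * total (isGood ξ) σ)
    (hsmall : ζ = 0 ∨ π.target * (ζ + 3 * ξ) - ξ < total (cappedSize ξ τ) σ) :
    (State.run π σ).gain = π.target := by
  have hl := ledger_run hT0 hb hF.wants_lt σ hσ
  have hle := hl.singles_le
  by_contra hne
  have hgain : (State.run π σ).gain < π.target := by omega
  have hpos : goodCount ξ (State.run π σ).singles ≠ 0 := by
    intro h0
    have h1 := balanced_run hT0 hb hF σ hσ
    unfold Balanced at h1
    omega
  have hns : ¬ Settled π ξ ζ (State.run π σ) := by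
    rintro (h | h)
    · exact hne h
    · exact hpos (goodCount_eq_zero.2 h.2)
  rcases hsmall with h0 | hsmall
  · exact hns (settled_run_of_eq_zero hT0 hb hF h0 σ hσ)
  have hT := ((settled_or_thrifty_run hT0 hb hF hτ σ hσ hn).resolve_left hns).capped_le
  have hξ := hF.nonneg
  have hsum : ((State.run π σ).waiting.map fun p => min p.fill (ζ + ξ)).sum ≤
      (State.run π σ).waiting.length * (ζ + ξ) := by
    have h : ∀ y ∈ (State.run π σ).waiting.map (fun p => min p.fill (ζ + ξ)), y ≤ ζ + ξ := by
      intro y hy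
      obtain ⟨p, _, rfl⟩ := List.mem_map.1 hy
      exact min_le_right _ _
    have := List.sum_le_card_nsmul _ _ h
    rwa [List.length_map, nsmul_eq_mul] at this
  have hopen : openFill ζ (State.run π σ) ≤ ξ := by
    by_cases hf : Filled ζ (State.run π σ)
    · obtain ⟨u, us, hu, -, -, huξ⟩ := exists_good_head hl hns hf
      rw [openFill, if_pos hf, hu]
      exact huξ.le
    · rw [openFill, if_neg hf]
      exact hξ
  have hk : ((State.run π σ).gain : ℝ) + 1 ≤ π.target := by exact_mod_cast hgain
  have := mul_le_mul_of_nonneg_right hk (by linarith : 0 ≤ 2 * ξ)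
  linarith

/-! ### Optimal packings -/

/-- The indicator of the sizes greater than `1 - ξ`. -/
def isVeryGood (ξ x : ℝ) : ℕ := open Classical in if 1 - ξ < x then 1 else 0

/-- The indicator of the sizes of medium items, which the algorithm only puts into the current
bin. -/
def isMedium (x : ℝ) : ℕ := open Classical in if 1 / 10 < x ∧ x < 1 / 2 then 1 else 0

/-- The size, capped at `ξ`, of an item of size at most `1 / 10`. -/
def capSize (ξ x : ℝ) : ℝ := open Classical in if x ≤ 1 / 10 then min x ξ else 0

/-- The sum of `f` over the items in bin `j`. -/
def binTotal {M : Type*} [AddCommMonoid M] (σ : List ℝ) (p : Fin σ.length → ℕ) (f : ℝ → M)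
    (j : ℕ) : M :=
  ∑ i with p i = j, f (σ.get i)

theorem total_eq_sum {M : Type*} [AddCommMonoid M] (f : ℝ → M) (σ : List ℝ) :
    total f σ = ∑ i : Fin σ.length, f (σ.get i) :=
  (Fin.sum_univ_fun_getElem σ f).symm

theorem sum_binTotal_le {M : Type*} [AddCommMonoid M] [PartialOrder M] [IsOrderedAddMonoid M]
    {σ : List ℝ} (p : Fin σ.length → ℕ) {f : ℝ → M} (hf : ∀ x ∈ σ, 0 ≤ f x) (K : Finset ℕ) :
    ∑ j ∈ K, binTotal σ p f j ≤ total f σ := by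
  simp only [binTotal, Finset.sum_filter, total_eq_sum]
  rw [Finset.sum_comm]
  refine Finset.sum_le_sum fun i _ => ?_
  rw [Finset.sum_ite_eq]
  split_ifs
  · exact le_rfl
  · exact hf _ (σ.get_mem i)

theorem level_le_binTotal {σ : List ℝ} (p : Fin σ.length → ℕ) (j : ℕ) {f : ℝ → ℝ}
    (hf : ∀ i, p i = j → σ.get i ≤ f (σ.get i)) : level σ p j ≤ binTotal σ p f j := by
  rw [level, ← Finset.sum_filter]
  exact Finset.sum_le_sum fun i hi => hf i (Finset.mem_filter.1 hi).2

theorem le_binTotal {M : Type*} [AddCommMonoid M] [PartialOrder M] [IsOrderedAddMonoid M]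
    {σ : List ℝ} {p : Fin σ.length → ℕ} {j : ℕ} {f : ℝ → M} (hf : ∀ x ∈ σ, 0 ≤ f x)
    {i : Fin σ.length} (hi : p i = j) : f (σ.get i) ≤ binTotal σ p f j :=
  Finset.single_le_sum (f := fun i => f (σ.get i)) (fun i _ => hf _ (σ.get_mem i))
    (Finset.mem_filter.2 ⟨Finset.mem_univ i, hi⟩)

theorem smallSize_nonneg {x : ℝ} (hx : 0 < x) : 0 ≤ smallSize x := by
  unfold smallSize
  split_ifs
  · exact le_rfl
  · exact hx.le

theorem capSize_nonneg {ξ x : ℝ} (hξ : 0 ≤ ξ) (hx : 0 < x) : 0 ≤ capSize ξ x := by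
  unfold capSize
  split_ifs
  · exact le_min hx.le hξ
  · exact le_rfl

section Bin

variable {σ : List ℝ} {p : Fin σ.length → ℕ} {j : ℕ} {ξ : ℝ}

theorem binTotal_add_mul (f : ℝ → ℝ) (g : ℝ → ℕ) (r : ℝ) :
    binTotal σ p (fun x => f x + r * g x) j = binTotal σ p f j + r * binTotal σ p g j := by
  simp [binTotal, Finset.sum_add_distrib, Finset.mul_sum]

theorem level_le_small_add_large (hσ : IsInput σ) :
    level σ p j ≤ binTotal σ p smallSize j + 1 * binTotal σ p isLarge j := by
  rw [← binTotal_add_mul]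
  refine level_le_binTotal p j fun i _ => ?_
  have := hσ _ (σ.get_mem i)
  unfold smallSize isLarge
  split_ifs <;> simp
  exact this.2

theorem level_le_of_isVeryGood_eq_zero (h : binTotal σ p (isVeryGood ξ) j = 0) :
    level σ p j ≤ binTotal σ p smallSize j + (1 - ξ) * binTotal σ p isLarge j := by
  rw [← binTotal_add_mul]
  refine level_le_binTotal p j fun i hi => ?_
  have h1 := le_binTotal (f := isVeryGood ξ) (fun x _ => Nat.zero_le _) hi
  rw [h] at h1
  have h2 : σ.get i ≤ 1 - ξ := by
    by_contra hn
    rw [isVeryGood, if_pos (not_le.1 hn)] at h1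
    omega
  unfold smallSize isLarge
  split_ifs <;> simp
  exact h2

theorem le_small_of_isMedium_ne_zero (hσ : IsInput σ) (h : binTotal σ p isMedium j ≠ 0) :
    1 / 10 ≤ binTotal σ p smallSize j := by
  obtain ⟨i, hi, hm⟩ := Finset.exists_ne_zero_of_sum_ne_zero h
  have hc : 1 / 10 < σ.get i ∧ σ.get i < 1 / 2 := by
    by_contra hn
    exact hm (if_neg hn)
  refine le_trans ?_ (le_binTotal (f := smallSize) (fun x hx => smallSize_nonneg (hσ x hx).1)
    (Finset.mem_filter.1 hi).2)
  rw [smallSize, if_neg (not_le.2 hc.2)]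
  exact hc.1.le

theorem le_capSize_of_isMedium_eq_zero (hσ : IsInput σ) (hξ : 0 ≤ ξ)
    (h : binTotal σ p isMedium j = 0) (hs : ξ ≤ binTotal σ p smallSize j) :
    ξ ≤ binTotal σ p (capSize ξ) j := by
  have hcap : ∀ x ∈ σ, 0 ≤ capSize ξ x := fun x hx => capSize_nonneg hξ (hσ x hx).1
  have hsm : ∀ i, p i = j → σ.get i < 1 / 2 → σ.get i ≤ 1 / 10 := by
    intro i hi hlt
    by_contra hn
    have h1 := le_binTotal (f := isMedium) (fun x _ => Nat.zero_le _) hi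
    rw [h, isMedium, if_pos ⟨not_le.1 hn, hlt⟩] at h1
    omega
  by_cases hex : ∃ i, p i = j ∧ σ.get i < 1 / 2 ∧ ξ ≤ σ.get i
  · obtain ⟨i, hi, hlt, hle⟩ := hex
    refine le_trans ?_ (le_binTotal hcap hi)
    rw [capSize, if_pos (hsm i hi hlt), min_eq_right hle]
  · push Not at hex
    refine hs.trans (Finset.sum_le_sum fun i hi => ?_)
    have hi' := (Finset.mem_filter.1 hi).2
    by_cases hlt : σ.get i < 1 / 2
    · rw [smallSize, if_neg (not_le.2 hlt), capSize, if_pos (hsm i hi' hlt),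
        min_eq_left (hex i hi' hlt).le]
    · rw [smallSize, if_pos (not_lt.1 hlt)]
      exact hcap _ (σ.get_mem i)

end Bin

/-- An optimal packing covers `a` bins with exactly one large item, `b` bins with none and `c` bins
with more than one. Of the first kind, `h` bins have a medium item; `m` of the others have a large
item of size at most `1 - ξ` and hence small items of total size at least `ξ`. -/
theorem exists_opt_eq {σ : List ℝ} (hσ : IsInput σ) : ∃ a b c h : ℕ, opt σ = a + b + c ∧
    a + 2 * c ≤ total isLarge σ ∧ ∀ ξ : ℝ, 0 ≤ ξ → ∃ m : ℕ,
      a ≤ h + m + total (isVeryGood ξ) σ ∧ (b + h / 10 + m * ξ : ℝ) ≤ total smallSize σ ∧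
      m * ξ ≤ total (capSize ξ) σ := by
  classical
  obtain ⟨p, hp⟩ := exists_coveredBins_eq_opt σ
  unfold coveredBins at hp
  set K := (Finset.univ.image p).filter (fun k => 1 ≤ level σ p k) with hK
  have hlev : ∀ j ∈ K, 1 ≤ level σ p j := fun j hj => (Finset.mem_filter.1 hj).2
  set N := binTotal σ p isLarge with hN
  set Q := binTotal σ p isMedium with hQ
  refine ⟨(K.filter fun j => N j = 1).card, (K.filter fun j => N j = 0).card,
    (K.filter fun j => 2 ≤ N j).card, (K.filter fun j => N j = 1 ∧ Q j ≠ 0).card, ?_, ?_, ?_⟩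
  · rw [← hp, Finset.card_eq_sum_ones, Finset.card_filter _ K, Finset.card_filter _ K,
      Finset.card_filter _ K, ← Finset.sum_add_distrib, ← Finset.sum_add_distrib]
    refine Finset.sum_congr rfl fun j _ => ?_
    split_ifs <;> omega
  · refine le_trans ?_ (sum_binTotal_le p (f := isLarge) (fun x _ => Nat.zero_le _) K)
    rw [Finset.card_filter, Finset.card_filter, Finset.mul_sum, ← Finset.sum_add_distrib]
    refine Finset.sum_le_sum fun j _ => ?_
    change _ ≤ N j
    split_ifs <;> omega
  · intro ξ hξ
    set V := binTotal σ p (isVeryGood ξ) with hV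
    have hgroup : ∀ j ∈ K, N j = 1 → V j = 0 → ξ ≤ binTotal σ p smallSize j := by
      intro j hj h1 h0
      have h2 := level_le_of_isVeryGood_eq_zero h0
      have h3 := hlev j hj
      rw [← hN, h1, Nat.cast_one] at h2
      linarith
    have hnonneg : ∀ j, 0 ≤ binTotal σ p smallSize j := fun j =>
      Finset.sum_nonneg fun i _ => smallSize_nonneg (hσ _ (σ.get_mem i)).1
    refine ⟨(K.filter fun j => N j = 1 ∧ Q j = 0 ∧ V j = 0).card, ?_, ?_, ?_⟩
    · refine le_trans ?_ (Nat.add_le_add_left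
        (sum_binTotal_le p (f := isVeryGood ξ) (fun x _ => Nat.zero_le _) K) _)
      rw [Finset.card_filter, Finset.card_filter, Finset.card_filter, ← Finset.sum_add_distrib,
        ← Finset.sum_add_distrib]
      refine Finset.sum_le_sum fun j _ => ?_
      change _ ≤ _ + V j
      split_ifs <;> omega
    · refine le_trans ?_
        (sum_binTotal_le p (f := smallSize) (fun x hx => smallSize_nonneg (hσ x hx).1) K)
      rw [Finset.natCast_card_filter, Finset.natCast_card_filter, Finset.natCast_card_filter,
        Finset.sum_div, Finset.sum_mul, ← Finset.sum_add_distrib, ← Finset.sum_add_distrib]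
      refine Finset.sum_le_sum fun j hj => ?_
      by_cases h0 : N j = 0
      · have h2 := level_le_small_add_large (p := p) (j := j) hσ
        have h3 := hlev j hj
        rw [← hN, h0, Nat.cast_zero] at h2
        simp only [h0, if_true, zero_ne_one, false_and, if_false]
        linarith
      by_cases h1 : N j = 1
      · by_cases hq : Q j = 0
        · by_cases hv : V j = 0
          · simpa [h1, hq, hv] using hgroup j hj h1 hv
          · simpa [h1, hq, hv] using hnonneg j
        · have := le_small_of_isMedium_ne_zero hσ hq
          simpa [h1, hq] using this
      · simpa [h0, h1] using hnonneg j
    · refine le_trans ?_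
        (sum_binTotal_le p (f := capSize ξ) (fun x hx => capSize_nonneg hξ (hσ x hx).1) K)
      rw [Finset.natCast_card_filter, Finset.sum_mul]
      refine Finset.sum_le_sum fun j hj => ?_
      split_ifs with hc
      · rw [one_mul]
        exact le_capSize_of_isMedium_eq_zero hσ hξ hc.2.1 (hgroup j hj hc.1 hc.2.2)
      · rw [zero_mul]
        exact Finset.sum_nonneg fun i _ => capSize_nonneg hξ (hσ _ (σ.get_mem i)).1

/-! ### The choice of the parameters -/

theorem total_mono {f g : ℝ → ℕ} {σ : List ℝ} (h : ∀ x ∈ σ, f x ≤ g x) :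
    total f σ ≤ total g σ :=
  List.sum_le_sum h

/-- The threshold for which the `g` largest items are good. -/
theorem exists_threshold {σ : List ℝ} (hσ : IsInput σ) {g : ℕ} (hg : g ≠ 0)
    (hgL : g ≤ total isLarge σ) : ∃ ξ : ℝ, 0 ≤ ξ ∧ ξ ≤ 1 / 2 ∧ g ≤ total (isGood ξ) σ ∧
      total (isVeryGood ξ) σ < g := by
  classical
  set E := σ.toFinset.filter fun x => 1 / 2 ≤ x ∧ g ≤ total (isGood (1 - x)) σ with hE
  have hEne : E.Nonempty := by
    have hF : (σ.toFinset.filter fun x => (1 / 2 : ℝ) ≤ x).Nonempty := by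
      by_contra hn
      have : total isLarge σ = 0 := by
        refine List.sum_eq_zero fun y hy => ?_
        obtain ⟨x, hx, rfl⟩ := List.mem_map.1 hy
        refine if_neg fun hx' => hn ⟨x, ?_⟩
        simp [hx] at hx' ⊢
        exact hx'
      omega
    obtain ⟨x, hx, hmin⟩ := Finset.exists_min_image _ id hF
    refine ⟨x, Finset.mem_filter.2 ⟨(Finset.mem_filter.1 hx).1, (Finset.mem_filter.1 hx).2,
      hgL.trans (total_mono fun y hy => ?_)⟩⟩
    by_cases hy' : 1 / 2 ≤ y
    · have := hmin y (Finset.mem_filter.2 ⟨List.mem_toFinset.2 hy, hy'⟩)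
      simp only [id] at this
      rw [isLarge, isGood, if_pos hy', if_pos (by linarith)]
    · rw [isLarge, if_neg hy']
      exact Nat.zero_le _
  obtain ⟨x, hx, hmax⟩ := Finset.exists_max_image E id hEne
  obtain ⟨hxσ, hx2, hxg⟩ := Finset.mem_filter.1 hx
  have hx1 := hσ x (List.mem_toFinset.1 hxσ)
  refine ⟨1 - x, by linarith, by linarith, hxg, ?_⟩
  by_contra hn
  push Not at hn
  have hF : (σ.toFinset.filter fun y => x < y).Nonempty := by
    by_contra hne
    have : total (isVeryGood (1 - x)) σ = 0 := by
      refine List.sum_eq_zero fun z hz => ?_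
      obtain ⟨y, hy, rfl⟩ := List.mem_map.1 hz
      refine if_neg fun hy' => hne ⟨y, Finset.mem_filter.2 ⟨List.mem_toFinset.2 hy, ?_⟩⟩
      linarith
    omega
  obtain ⟨y, hy, hmin⟩ := Finset.exists_min_image _ id hF
  obtain ⟨hyσ, hxy⟩ := Finset.mem_filter.1 hy
  have hyE : y ∈ E := by
    refine Finset.mem_filter.2 ⟨hyσ, by linarith, hn.trans (total_mono fun z hz => ?_)⟩
    by_cases hz' : x < z
    · have := hmin z (Finset.mem_filter.2 ⟨List.mem_toFinset.2 hz, hz'⟩)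
      simp only [id] at this
      rw [isVeryGood, isGood, if_pos (by linarith), if_pos (by linarith)]
    · rw [isVeryGood, if_neg (by linarith)]
      exact Nat.zero_le _
  have := hmax y hyE
  simp only [id] at this
  linarith

/-- The parameters of the algorithm for the target `k`, the highest level `T` of waiting bins, and
the width `ℓ` of the scales: the item sizes are divided into the scales
`T * (2/3)^(ℓ * (w + 1)) < y ≤ T * (2/3)^(ℓ * w)`, and the items of this scale fill the waiting bins
up to the level `T * (2/3)^(ℓ * w)`. The scale that matters need not be known. -/
def Params.ofScale (k : ℕ) (T : ℝ) (ℓ : ℕ) : Params where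
  target := k
  budget := k * (T + 1 / 10) + 1
  wants y l := ∃ w : ℕ, T * (2 / 3) ^ (ℓ * (w + 1)) < y ∧ l < T * (2 / 3) ^ (ℓ * w)

theorem Params.target_ofScale (k : ℕ) (T : ℝ) (ℓ : ℕ) : (Params.ofScale k T ℓ).target = k := rfl

theorem Params.budget_ofScale (k : ℕ) (T : ℝ) (ℓ : ℕ) :
    (Params.ofScale k T ℓ).budget = k * (T + 1 / 10) + 1 := rfl

theorem Params.wants_lt {k ℓ : ℕ} {T : ℝ} (hT : 0 ≤ T) (y l : ℝ)
    (h : (Params.ofScale k T ℓ).wants y l) : l < T := by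
  obtain ⟨w, -, hw⟩ := h
  exact hw.trans_le (mul_le_of_le_one_right hT (pow_le_one₀ (by norm_num) (by norm_num)))

/-- Every threshold `ξ` fits one of the parameters `T = (2/3)^j` with `j < 2 * ℓ`. -/
theorem exists_fits (k : ℕ) {n ℓ : ℕ} (hℓ : ℓ ≠ 0) (hn : (n : ℝ) * (2 / 3) ^ ℓ ≤ 1) {ξ : ℝ}
    (hξ0 : 0 ≤ ξ) (hξ : ξ ≤ 1 / 2) : ∃ (j : ℕ) (ζ τ : ℝ), j < 2 * ℓ ∧
      Fits (Params.ofScale k ((2 / 3) ^ j) ℓ) ((2 / 3) ^ j) ξ ζ τ ∧ 0 ≤ τ ∧ n * τ ≤ ζ ∧ ζ ≤ 1 ∧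
      ζ ≤ 3 / 2 * ξ ∧ (((2 / 3 : ℝ) ^ j = ζ) ∨ (2 / 3 : ℝ) ^ j ≤ (2 / 3) ^ ℓ) := by
  rcases hξ0.eq_or_lt with rfl | hpos
  · refine ⟨ℓ, 0, 0, by omega, ?_, le_rfl, by simp, zero_le_one, by simp, Or.inr le_rfl⟩
    refine ⟨le_rfl, hξ, le_rfl, by positivity, Params.wants_lt (by positivity), ?_, ?_, rfl⟩
    · intro y l _ h1 h2
      linarith
    · rintro y l hy - ⟨w, hw, -⟩
      have : (0 : ℝ) < (2 / 3) ^ ℓ * (2 / 3) ^ (ℓ * (w + 1)) := by positivity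
      linarith
  obtain ⟨q, hq1, hq2⟩ := exists_nat_pow_near_of_lt_one hpos (by linarith : ξ ≤ 1)
    (by norm_num : (0 : ℝ) < 2 / 3) (by norm_num)
  obtain ⟨j, w, hjw, hj, hw⟩ : ∃ j w, q = j + ℓ * w ∧ j < 2 * ℓ ∧ (w = 0 ∨ ℓ ≤ j) := by
    by_cases hqℓ : q < ℓ
    · exact ⟨q, 0, by simp, by omega, Or.inl rfl⟩
    · have h1 := Nat.mod_add_div q ℓ
      have h2 := Nat.mod_lt q (Nat.pos_of_ne_zero hℓ)
      have h3 : 1 ≤ q / ℓ := (Nat.one_le_div_iff (Nat.pos_of_ne_zero hℓ)).2 (not_lt.1 hqℓ)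
      obtain ⟨w, hw⟩ := Nat.exists_eq_add_of_le h3
      refine ⟨ℓ + q % ℓ, w, ?_, by omega, Or.inr (by omega)⟩
      rw [hw] at h1
      linarith [mul_add ℓ 1 w]
  have hζ : (2 / 3 : ℝ) ^ q = (2 / 3) ^ j * (2 / 3) ^ (ℓ * w) := by rw [hjw, pow_add]
  have hρ1 : ∀ m : ℕ, (2 / 3 : ℝ) ^ m ≤ 1 := fun m => pow_le_one₀ (by norm_num) (by norm_num)
  refine ⟨j, (2 / 3) ^ q, (2 / 3) ^ q * (2 / 3) ^ ℓ, hj, ?_, by positivity, ?_, hρ1 q, ?_, ?_⟩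
  · refine ⟨hξ0, hξ, hq2, ?_, Params.wants_lt (by positivity), ?_, ?_, rfl⟩
    · rw [hζ]
      exact mul_le_of_le_one_right (by positivity) (hρ1 _)
    · intro y l hy _ hl
      refine ⟨w, ?_, hζ ▸ hl⟩
      rwa [mul_add, mul_one, pow_add, ← mul_assoc, ← hζ]
    · rintro y l hy hl ⟨v, hv1, hv2⟩
      have h1 := hv1.trans_le hy
      rw [hζ, mul_lt_mul_iff_right₀ (by positivity),
        pow_lt_pow_iff_right_of_lt_one₀ (by norm_num) (by norm_num)] at h1
      have h2 : w < v + 1 := lt_of_mul_lt_mul_left h1 (Nat.zero_le ℓ)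
      have h3 : (2 / 3 : ℝ) ^ (ℓ * v) ≤ (2 / 3) ^ (ℓ * w) :=
        pow_le_pow_of_le_one (by norm_num) (by norm_num)
          (Nat.mul_le_mul_left ℓ (Nat.lt_succ_iff.1 h2))
      have h4 := mul_le_mul_of_nonneg_left h3 (by positivity : (0 : ℝ) ≤ (2 / 3) ^ j)
      rw [← hζ] at h4
      linarith
  · have := mul_le_mul_of_nonneg_left hn (by positivity : (0 : ℝ) ≤ (2 / 3) ^ q)
    linarith
  · rw [pow_succ] at hq1
    linarith
  · rcases hw with rfl | hw
    · exact Or.inl (by rw [hζ]; simp)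
    · exact Or.inr (pow_le_pow_of_le_one (by norm_num) (by norm_num) hw)

/-- The targets that the advice can describe. The truncated subtraction makes `0` the first one. -/
def targetOf (e : ℕ) : ℕ := ⌊((21 / 20 : ℝ) ^ e)⌋₊ - 1

/-- Every number `R` is approximated from below by a target, up to a factor of `21/20` and an
additive constant. -/
theorem exists_targetOf {R : ℝ} {m : ℕ} (hR : R ≤ 2 ^ m) : ∃ e ≤ 15 * m,
    (targetOf e = 0 ∨ (targetOf e : ℝ) + 1 ≤ R) ∧ 20 / 21 * R - 2 ≤ targetOf e := by
  by_cases h1 : 1 ≤ R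
  · obtain ⟨e, he1, he2⟩ := exists_nat_pow_near h1 (by norm_num : (1 : ℝ) < 21 / 20)
    refine ⟨e, ?_, ?_⟩
    · have h2 : (2 : ℝ) ^ m ≤ (21 / 20) ^ (15 * m) := by
        rw [pow_mul]
        exact pow_le_pow_left₀ (by norm_num) (by norm_num) m
      exact (pow_le_pow_iff_right₀ (by norm_num : (1 : ℝ) < 21 / 20)).1
        ((he1.trans hR).trans h2)
    · have hpos : (1 : ℝ) ≤ (21 / 20) ^ e := one_le_pow₀ (by norm_num)
      have h3 : 1 ≤ ⌊((21 / 20 : ℝ) ^ e)⌋₊ := Nat.one_le_floor_iff _ |>.2 hpos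
      have h4 : (targetOf e : ℝ) = ⌊((21 / 20 : ℝ) ^ e)⌋₊ - 1 := by
        rw [targetOf, Nat.cast_sub h3, Nat.cast_one]
      have h5 := Nat.floor_le (zero_le_one.trans hpos)
      have h6 := Nat.lt_floor_add_one ((21 / 20 : ℝ) ^ e)
      rw [pow_succ] at he2
      rw [h4]
      exact ⟨Or.inr (by linarith), by linarith⟩
  · refine ⟨0, Nat.zero_le _, Or.inl (by simp [targetOf]), ?_⟩
    simp only [targetOf, pow_zero, Nat.floor_one, Nat.sub_self, Nat.cast_zero]
    linarith

/-! ### The competitive ratio -/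

theorem Ledger.le_covered {π : Params} {T : ℝ} {s : State} {L : ℕ} {S : ℝ} (h : Ledger π T s L S)
    (hg : s.gain = π.target) :
    (L : ℝ) / 2 + (π.target - 1) / 2 +
      2 / 3 * (S - π.target * (T + 1 / 10) - π.budget - 11 / 10) ≤ s.covered := by
  obtain ⟨q, d, hc, hL, hS⟩ := h.count
  have h1 := h.singles_le
  have h2 := h.spare_le
  have h3 := h.used_le
  have h4 := h.current_lt
  have h5 : (s.waiting.map Bin.fill).sum ≤ s.waiting.length * (T + 1 / 10) := by
    have h : ∀ y ∈ s.waiting.map Bin.fill, y ≤ T + 1 / 10 := by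
      intro y hy
      obtain ⟨p, hp, rfl⟩ := List.mem_map.1 hy
      exact (h.mem_waiting p hp).2.2
    have := List.sum_le_card_nsmul _ _ h
    rwa [List.length_map, nsmul_eq_mul] at this
  have h6 : (L : ℝ) ≤ π.target + 2 * q + 1 := by
    have : L ≤ π.target + 2 * q + 1 := by omega
    exact_mod_cast this
  have h7 : (s.covered : ℝ) = π.target + q + d := by
    rw [hc, hg]
    push_cast
    ring
  rw [h7]
  linarith

theorem total_isLarge_le (σ : List ℝ) : total isLarge σ ≤ σ.length := by
  have h : ∀ y ∈ σ.map isLarge, y ≤ 1 := by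
    intro y hy
    obtain ⟨x, _, rfl⟩ := List.mem_map.1 hy
    unfold isLarge
    split_ifs <;> simp
  simpa [total] using List.sum_le_card_nsmul _ _ h

theorem total_capSize_le {σ : List ℝ} (hσ : IsInput σ) {ξ τ : ℝ} :
    total (capSize ξ) σ ≤ total (cappedSize ξ τ) σ + total (tinySize τ) σ := by
  unfold total
  rw [← List.sum_map_add]
  refine List.sum_le_sum fun x hx => ?_
  have hx0 := (hσ x hx).1
  by_cases hτ : x ≤ τ
  · rw [tinySize_of_le hτ, cappedSize_of_le hτ, zero_add, capSize]
    split_ifs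
    · exact min_le_left _ _
    · exact hx0.le
  · have h0 := tinySize_nonneg (τ := τ) hx0.le
    have h1 : capSize ξ x = cappedSize ξ τ x := by
      simp only [capSize, cappedSize, not_le.1 hτ, true_and]
    linarith

/-- For suitable parameters the algorithm covers at least `8/15` of the optimum. -/
theorem exists_params {σ : List ℝ} (hσ : IsInput σ) {r : ℕ} (hr : r ≠ 0) (hn : σ.length ≤ 2 ^ r) :
    ∃ e ≤ 15 * r, ∃ j < 4 * r, 8 / 15 * (opt σ : ℝ) - 10 ≤
      (State.run (Params.ofScale (targetOf e) ((2 / 3) ^ j) (2 * r)) σ).covered := by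
  obtain ⟨a, b, c, h, hopt, hac, hm⟩ := exists_opt_eq hσ
  have hLn := total_isLarge_le σ
  set L := total isLarge σ with hL
  have hacR : (a : ℝ) + 2 * c ≤ L := by exact_mod_cast hac
  have hh0 : (0 : ℝ) ≤ h := Nat.cast_nonneg h
  have hL2 : (L : ℝ) ≤ 2 ^ r := by exact_mod_cast hLn.trans hn
  have hb0 : (0 : ℝ) ≤ b := Nat.cast_nonneg b
  have hc0 : (0 : ℝ) ≤ c := Nat.cast_nonneg c
  have hL0 : (0 : ℝ) ≤ L := Nat.cast_nonneg L
  have hoptR : (opt σ : ℝ) = a + b + c := by rw [hopt]; push_cast; ring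
  obtain ⟨e, he, hk1, hk2⟩ := exists_targetOf (R := (2 * a - L - 2 * h) / 10) (m := r)
    (by linarith)
  set k := targetOf e with hk
  -- the `k` bins gain `k / 2` and waste small items of total size `2 * k / 10`, which costs
  -- `2 / 15 * k`; what remains is at least `(2 * a - L - 2 * h) / 30`, up to a constant
  have hk0 : (0 : ℝ) ≤ k := Nat.cast_nonneg k
  by_cases hkz : k = 0
  · refine ⟨e, he, 0, by omega, ?_⟩
    have hkz' : (k : ℝ) = 0 := by rw [hkz, Nat.cast_zero]
    rw [hkz'] at hk2
    rw [← hk, hkz]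
    have hl := ledger_run (π := Params.ofScale 0 ((2 / 3) ^ 0) (2 * r)) (T := (2 / 3) ^ 0)
      (by norm_num) (by simp [Params.ofScale]) (Params.wants_lt (by norm_num)) σ hσ
    have hv := hl.le_covered (by have := hl.singles_le; simp only [Params.ofScale] at this ⊢; omega)
    obtain ⟨m, -, hS, -⟩ := hm 0 le_rfl
    rw [Params.target_ofScale, Params.budget_ofScale] at hv
    rw [Nat.cast_zero] at hv
    rw [← hL] at hv
    rw [hoptR]
    linarith
  have hk1' := hk1.resolve_left hkz
  have hkL : k ≤ L := by
    have : (k : ℝ) ≤ L := by linarith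
    exact_mod_cast this
  -- the least number of good items for which they outnumber the bad ones by `k`
  obtain ⟨ξ, hξ0, hξ, hg1, hg2⟩ := exists_threshold hσ (g := (L + k + 1) / 2) (by omega) (by omega)
  have hρ : (σ.length : ℝ) * (2 / 3) ^ (2 * r) ≤ 1 := by
    have h1 : (σ.length : ℝ) ≤ 2 ^ r := by exact_mod_cast hn
    calc (σ.length : ℝ) * (2 / 3) ^ (2 * r) ≤ 2 ^ r * (2 / 3) ^ (2 * r) := by gcongr
      _ = (8 / 9) ^ r := by rw [pow_mul, ← mul_pow]; norm_num
      _ ≤ 1 := pow_le_one₀ (by norm_num) (by norm_num)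
  obtain ⟨j, ζ, τ, hj, hF, hτ, hnτ, hζ1, hζ, hT⟩ := exists_fits k (by omega : 2 * r ≠ 0) hρ hξ0 hξ
  obtain ⟨m, hm1, hm2, hm3⟩ := hm ξ hξ0
  refine ⟨e, he, j, by omega, ?_⟩
  set T : ℝ := (2 / 3) ^ j with hTdef
  have hT0 : 0 ≤ T := by positivity
  have hbud : 0 ≤ (Params.ofScale k T (2 * r)).budget := by
    simp only [Params.ofScale]
    positivity
  have hmk : (9 * k + 10 : ℝ) ≤ 2 * m := by
    have h1 : 2 * a + 1 ≤ 2 * h + 2 * m + L + k := by omega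
    have h2 : (2 * a + 1 : ℝ) ≤ 2 * h + 2 * m + L + k := by exact_mod_cast h1
    linarith
  have hmξ := mul_le_mul_of_nonneg_right hmk hξ0
  have hgain := gain_run_eq hT0 hbud hF hτ σ hσ (hnτ.trans hζ1)
    (by simp only [Params.ofScale]; omega) (by
      rcases hξ0.eq_or_lt with h0 | hpos
      · left
        have := hF.le_level
        linarith
      · right
        have h1 := total_capSize_le hσ (ξ := ξ) (τ := τ)
        have h2 := (total_tinySize_le hτ σ).trans hnτ
        have h3 := mul_le_mul_of_nonneg_left hζ hk0
        simp only [Params.ofScale]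
        linarith)
  have hv := (ledger_run hT0 hbud hF.wants_lt σ hσ).le_covered hgain
  rw [Params.target_ofScale, Params.budget_ofScale] at hv
  -- the highest level `T` of waiting bins is paid for by the optimal bins with small items of total
  -- size at least `ξ`, or it is negligible
  have hkT : 2 * (k * T) ≤ m * ξ + 2 := by
    rcases hT with hT | hT
    · have h1 := mul_le_mul_of_nonneg_left hζ hk0
      have h2 := mul_nonneg hk0 hξ0
      rw [hT]
      linarith
    · have h1 : (k : ℝ) ≤ σ.length := by exact_mod_cast hkL.trans hLn
      have h2 := mul_le_mul h1 hT hT0 (Nat.cast_nonneg _)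
      have h3 := mul_nonneg (Nat.cast_nonneg m : (0 : ℝ) ≤ m) hξ0
      linarith
  rw [← hL] at hv
  rw [hoptR]
  linarith

/-! ### The advice -/

open Classical in
/-- The position of the first `false` on the tape. -/
def adviceLength (Φ : AdviceTape) : ℕ := if h : ∃ i, Φ i = false then Nat.find h else 0

/-- The number on the tape: its length in unary, terminated by `false`, and then its binary
digits. -/
def decode (Φ : AdviceTape) : ℕ :=
  Nat.ofBits fun i : Fin (adviceLength Φ) => Φ (adviceLength Φ + 1 + i)

/-- The tape with the number `M`, which has `t` binary digits. -/
def encode (t M : ℕ) : AdviceTape := fun i =>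
  if i < t then true else if i = t then false else M.testBit (i - (t + 1))

theorem decode_eq {t M : ℕ} (hM : M < 2 ^ t) {Φ : AdviceTape}
    (h : ∀ j < 2 * t + 1, Φ j = encode t M j) : decode Φ = M := by
  have ht : adviceLength Φ = t := by
    have hex : ∃ i, Φ i = false := ⟨t, by rw [h t (by omega)]; simp [encode]⟩
    rw [adviceLength, dif_pos hex, Nat.find_eq_iff]
    refine ⟨by rw [h t (by omega)]; simp [encode], fun i hi => ?_⟩
    rw [h i (by omega)]
    simp [encode, hi]
  unfold decode
  rw [ht]
  apply Nat.eq_of_testBit_eq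
  intro i
  by_cases hi : i < t
  · rw [Nat.testBit_ofBits_lt _ _ hi, h _ (by simp only; omega)]
    simp only [encode]
    rw [if_neg (by omega), if_neg (by omega)]
    congr 1
    omega
  · rw [Nat.testBit_ofBits_ge _ _ (not_lt.1 hi)]
    exact (Nat.testBit_eq_false_of_lt
      (hM.trans_le (Nat.pow_le_pow_right (by norm_num) (not_lt.1 hi)))).symm

/-- The parameters described by a number. -/
def paramsOfCode (M : ℕ) : Params :=
  Params.ofScale (targetOf M.unpair.1) ((2 / 3) ^ M.unpair.2.unpair.1) (2 * M.unpair.2.unpair.2)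

/-- The algorithm that reads its parameters from the tape. -/
def algorithm : OnlineAlgorithm where
  place Φ l := (State.run (paramsOfCode (decode Φ)) l).last

/-- The number of binary digits of the advice for inputs of length less than `2 ^ r`. -/
def digits (r : ℕ) : ℕ := 4 * Nat.log 2 r + 12

/-- The number of bits of advice on inputs of length at most `n`. -/
def adviceBits (n : ℕ) : ℕ := 2 * digits (Nat.log 2 n + 1) + 1

theorem pair_lt_two_pow_digits {e j r : ℕ} (hr : r ≠ 0) (he : e ≤ 15 * r) (hj : j < 4 * r) :
    Nat.pair e (Nat.pair j r) < 2 ^ digits r := by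
  have hr1 : r * 1 ≤ r * r := Nat.mul_le_mul_left r (Nat.pos_of_ne_zero hr)
  have h1 : Nat.pair j r < (4 * r) ^ 2 :=
    (Nat.pair_lt_max_add_one_sq j r).trans_le (Nat.pow_le_pow_left (by omega) 2)
  have h2 : Nat.pair e (Nat.pair j r) < (16 * (r * r)) ^ 2 :=
    (Nat.pair_lt_max_add_one_sq _ _).trans_le (Nat.pow_le_pow_left (by
      have : (4 * r) ^ 2 = 16 * (r * r) := by ring
      have : 0 < r := Nat.pos_of_ne_zero hr
      omega) 2)
  refine h2.trans_le ?_
  calc (16 * (r * r)) ^ 2 = 2 ^ 8 * r ^ 4 := by ring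
    _ ≤ 2 ^ 8 * (2 ^ (Nat.log 2 r + 1)) ^ 4 := Nat.mul_le_mul_left _
        (Nat.pow_le_pow_left (Nat.lt_pow_succ_log_self (by norm_num) r).le 4)
    _ = 2 ^ digits r := by
        rw [digits, ← pow_mul, ← pow_add]
        congr 1
        ring

theorem adviceBits_isBigO :
    (fun n : ℕ => (adviceBits n : ℝ)) =O[atTop] fun n : ℕ => Real.log (Real.log (n : ℝ)) := by
  have h1 : Tendsto (fun n : ℕ => Real.log (n : ℝ)) atTop atTop :=
    Real.tendsto_log_atTop.comp tendsto_natCast_atTop_atTop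
  have h2 : Tendsto (fun n : ℕ => Real.log (Real.log (n : ℝ))) atTop atTop :=
    Real.tendsto_log_atTop.comp h1
  refine IsBigO.of_bound 73 ?_
  filter_upwards [h1.eventually_ge_atTop 1, h2.eventually_ge_atTop 1] with n hn1 hn2
  have hlog2 : (1 / 2 : ℝ) < Real.log 2 := by linarith [Real.log_two_gt_d9]
  have hlog : ∀ m : ℕ, m ≠ 0 → (Nat.log 2 m : ℝ) ≤ 2 * Real.log m := by
    intro m hm
    have h3 : ((2 : ℕ) : ℝ) ^ Nat.log 2 m ≤ m := by exact_mod_cast Nat.pow_log_le_self 2 hm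
    have h4 := Real.log_le_log (by positivity) h3
    rw [Real.log_pow, Nat.cast_ofNat] at h4
    have h5 := mul_le_mul_of_nonneg_left hlog2.le (Nat.cast_nonneg (α := ℝ) (Nat.log 2 m))
    linarith
  have hn0 : n ≠ 0 := by
    rintro rfl
    norm_num at hn1
  have h3 : ((Nat.log 2 n + 1 : ℕ) : ℝ) ≤ 3 * Real.log n := by
    push_cast
    linarith [hlog n hn0]
  have h4 : Real.log (Nat.log 2 n + 1 : ℕ) ≤ Real.log 3 + Real.log (Real.log n) := by
    rw [← Real.log_mul (by norm_num) (by linarith)]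
    exact Real.log_le_log (by positivity) h3
  have h5 : Real.log 3 ≤ 2 := by
    have := Real.log_le_sub_one_of_pos (by norm_num : (0 : ℝ) < 3)
    linarith
  have h6 := hlog (Nat.log 2 n + 1) (Nat.succ_ne_zero _)
  rw [Real.norm_of_nonneg (Nat.cast_nonneg _), Real.norm_of_nonneg (by linarith)]
  unfold adviceBits digits
  push_cast at h4 h6 ⊢
  linarith

theorem algorithm_isAsymptoticallyCompetitive :
    algorithm.IsAsymptoticallyCompetitive adviceBits (8 / 15) := by
  refine ⟨fun _ => 10, ?_, fun n σ hσ hn => ?_⟩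
  · exact isLittleO_const_left.2 (Or.inr (tendsto_norm_atTop_atTop.comp
      tendsto_natCast_atTop_atTop))
  · have hn' : σ.length ≤ 2 ^ (Nat.log 2 n + 1) :=
      hn.trans (Nat.lt_pow_succ_log_self (by norm_num) n).le
    have hr : Nat.log 2 n + 1 ≠ 0 := Nat.succ_ne_zero _
    obtain ⟨e, he, j, hj, hle⟩ := exists_params hσ hr hn'
    have hM := pair_lt_two_pow_digits hr he hj
    set r := Nat.log 2 n + 1
    have hdec := decode_eq hM (Φ := encode (digits r) (Nat.pair e (Nat.pair j r))) fun _ _ => rfl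
    have hπ : paramsOfCode (Nat.pair e (Nat.pair j r)) =
        Params.ofScale (targetOf e) ((2 / 3) ^ j) (2 * r) := by
      simp [paramsOfCode]
    refine ⟨encode (digits r) (Nat.pair e (Nat.pair j r)), fun Φ' hΦ' => ?_, ?_⟩
    · have hdec' := decode_eq hM hΦ'
      funext i
      simp only [OnlineAlgorithm.packing, algorithm, hdec, hdec']
    · have hT : (0 : ℝ) ≤ (2 / 3) ^ j := by positivity
      have hb : 0 ≤ (Params.ofScale (targetOf e) ((2 / 3) ^ j) (2 * r)).budget := by
        rw [Params.budget_ofScale]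
        positivity
      have hcov := covered_run_le hT hb (Params.wants_lt hT) σ hσ
      have hcov' :
          ((State.run (Params.ofScale (targetOf e) ((2 / 3) ^ j) (2 * r)) σ).covered : ℝ) ≤
          coveredBins σ (algorithm.packing (encode (digits r) (Nat.pair e (Nat.pair j r))) σ) := by
        have hp : algorithm.packing (encode (digits r) (Nat.pair e (Nat.pair j r))) σ =
            fun i : Fin σ.length =>
            (State.run (Params.ofScale (targetOf e) ((2 / 3) ^ j) (2 * r))
              (σ.take ((i : ℕ) + 1))).last := by
          funext i
          simp only [OnlineAlgorithm.packing, algorithm, hdec, hπ]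
        rw [hp]
        exact_mod_cast hcov
      exact hle.trans hcov'

end BinCovering

end

/-- There is an online bin covering algorithm that uses `O(log log n)` bits of advice on inputs of
length at most `n` and has an asymptotic competitive ratio of at least `8/15`; moreover it is
asymptotically competitive for the constant `8/15` itself. -/
theorem mainTheorem3 :
    ∃ (A : BinCovering.OnlineAlgorithm) (s : ℕ → ℕ),
      (fun n : ℕ => (s n : ℝ)) =O[atTop] (fun n : ℕ => Real.log (Real.log (n : ℝ))) ∧
      A.IsAsymptoticallyCompetitive s (8 / 15) ∧
      (((8 / 15 : ℝ)) : EReal) ≤ A.asymptoticCompetitiveRatio s := by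
  have h := BinCovering.algorithm_isAsymptoticallyCompetitive
  exact ⟨BinCovering.algorithm, BinCovering.adviceBits, BinCovering.adviceBits_isBigO, h,
    le_sSup ⟨8 / 15, h, rfl⟩⟩
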